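/- **Setting.** Let $d\in\{2,3\}$, let $\Omega\subset\mathbb R^d$ be a bounded Lipschitz domain with boundary $\Gamma$, let $\Gamma_{u,D}\subset\Gamma$ and $\Gamma_{p_i,N}\subset\Gamma$ ($1\le i\le n$, $n\ge1$) be relatively open, and put $U=\{u\in H^1(\Omega)^d: u=0 \text{ on }\Gamma_{u,D}\}$, $V_i=\{v\in H(\mathrm{div},\Omega): v\cdot n=0\text{ on }\Gamma_{p_i,N}\}$, and $P_i=L^2(\Omega)$ if $\Gamma_{u,D}\ne\Gamma$, $P_i=L^2_0(\Omega)$ (mean value zero) if $\Gamma_{u,D}=\Gamma$; in the latter case assume $\Gamma_{p_i,N}=\Gamma$ for all $i$. Put $V=\prod_iV_i$, $P=\prod_iP_i$; $(\cdot,\cdot)$ and $\|\cdot\|$ are the $L^2(\Omega)$ inner product and norm, $\varepsilon(u)=\frac12(\nabla u+(\nabla u)^T)$, and $\mathrm{Div}\,v=(\mathrm{div}\,v_1,\dots,\mathrm{div}\,v_n)^T$. Assume that, with constants $c_K,\beta_s,\beta_d>0$, $\|\varepsilon(w)\|\ge c_K\|\mathrm{div}\,w\|$ for all $w\in U$, and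 $$\inf_{q\in P_i}\sup_{v\in V_i}\frac{(\mathrm{div}\,v,q)}{\|v\|_{\mathrm{div}}\|q\|}\ge\beta_d\ (1\le i\le n),\qquad \inf_{(q_1,\dots,q_n)\in P}\ \sup_{u\in U}\frac{(\mathrm{div}\,u,\sum_iq_i)}{\|u\|_1\,\|\sum_iq_i\|}\ge\beta_s .$$ The model parameters are $\lambda>0$, $K_i>0$, $\alpha_i>0$, $c_{p_i}\ge0$, $\beta_{ij}=\beta_{ji}\ge0$ ($i\neq j$), and $\tau>0$ is the time step size. Put $\beta_{ii}=\sum_{j\ne i}\beta_{ij}$, $R_i^{-1}=\tau^{-1}K_i^{-1}\alpha_i^2$, $\alpha_{p_i}=c_{p_i}/\alpha_i^2$, $\alpha_{ij}=\tau\beta_{ij}/(\alpha_i\alpha_j)$, $R^{-1}=\max_iR_i^{-1}$, $\lambda_0=\max\{1,\lambda\}$. Let $\Lambda_1$ have diagonal entries $\alpha_{ii}$ and off-diagonal entries $-\alpha_{ij}$, let $\Lambda_2=\mathrm{diag}(\alpha_{p_1},\dots,\alpha_{p_n})$, $\Lambda_3=R\,I$, let all entries of $\Lambda_4$ be $1/\lambda_0$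 and all entries of $\Lambda_L$ be $L$, and put $\Lambda=\Lambda_1+\Lambda_2+\Lambda_3+\Lambda_4$, $\Lambda_e=\Lambda+\Lambda_L$. Define $$\|u\|_U^2=\|\varepsilon(u)\|^2+\lambda\|\mathrm{div}\,u\|^2,\quad \|v\|_{V_e}^2=\sum_i(R_i^{-1}v_i,v_i)+(\Lambda_e^{-1}\mathrm{Div}\,v,\mathrm{Div}\,v),\quad \|p\|_{P_e}^2=(\Lambda_ep,p).$$ Let $f\in L^2(\Omega)^d$, $g_i\in L^2(\Omega)$, and let $(u;v;p)\in U\times V\times P$ solve, for all $(w;z;q)\in U\times V\times P$ and $1\le i\le n$, $$(\varepsilon(u),\varepsilon(w))+\lambda(\mathrm{div}\,u,\mathrm{div}\,w)-\sum_j(p_j,\mathrm{div}\,w)=(f,w),\tag{1}$$ $$(R_i^{-1}v_i,z_i)-(p_i,\mathrm{div}\,z_i)=0,$$ $$-(\mathrm{div}\,u,q_i)-(\mathrm{div}\,v_i,q_i)-(\alpha_{p_i}+\alpha_{ii})(p_i,q_i)+\sum_{j\ne i}\alpha_{ij}(p_j,q_i)=(g_i,q_i).$$ Fixed-stress iteration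 (Algorithm 1): starting from any $(u^0;v^0;p^0)\in U\times V\times P$ (where $v^0$ plays no role), given $u^m,p^m$ let $(v^{m+1},p^{m+1})\in V\times P$ solve, for all $(z;q)\in V\times P$ and $1\le i\le n$, $$-(\mathrm{div}\,v_i^{m+1},q_i)-(\alpha_{p_i}+\alpha_{ii})(p_i^{m+1},q_i)+\sum_{j\neq i}\alpha_{ij}(p_j^{m+1},q_i)-L\Big(\sum_jp_j^{m+1},q_i\Big)=(g_i,q_i)-L\Big(\sum_jp^m_j,q_i\Big)+(\mathrm{div}\,u^m,q_i),$$ $$(R_i^{-1}v_i^{m+1},z_i)-(p_i^{m+1},\mathrm{div}\,z_i)=0,$$ and then let $u^{m+1}\in U$ solve (1) with $(u,p)$ replaced by $(u^{m+1},p^{m+1})$. The errors are $e_u^m=u^m-u$, $e_v^m=v^m-v$, $e_p^m=p^m-p$. Put $$\mathrm{rate}(\lambda)=\Big(\frac{L^{-1}}{\beta_s^{-2}+\lambda}+1\Big)^{-1/2}.$$ **Theorem 3.2.** There are constants $C,C'>0$ depending only on $\Omega,\Gamma_{u,D},c_K,\beta_s,\beta_d$, hence independent of $n$, of all model parameters,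 of $\tau$ and of $L$, such that for every $L\ge 1/(\lambda+c_K^2)$ the following holds. (a) For every initial guess, $\|\sum_ie_{p_i}^{m+1}\|\le\mathrm{rate}(\lambda)\,\|\sum_ie_{p_i}^m\|$ for all $m\ge1$, and $$\|e_u^m\|_U\le C_u\,[\mathrm{rate}(\lambda)]^m\quad(m\ge0),\qquad \|e_v^m\|_{V_e}+\|e_p^m\|_{P_e}\le C_{vp}\,[\mathrm{rate}(\lambda)]^m\quad(m\ge1),$$ where $C_u=C\big(\|\sum_ie_{p_i}^0\|+\|e_u^0\|_U\big)$ and $C_{vp}=C'\big(\sqrt L\,\|\sum_ie_{p_i}^0\|+\|e_u^0\|_U\big)$. (b) If moreover $u^0$ is computed from $p^0$, that is, (1) holds with $(u,p)$ replaced by $(u^0,p^0)$, then the contraction estimate holds for all $m\ge0$, and the bounds in (a) hold with $C_u=C\,\|\sum_ie_{p_i}^0\|$ and $C_{vp}=C'\sqrt L\,\|\sum_ie_{p_i}^0\|$. -/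

import Mathlib

noncomputable section

namespace MPET

open MeasureTheory
open scoped ContDiff

/-! ### Domains and boundary parts -/

/-- The space `ℝ^d` with its Euclidean norm. -/
abbrev Pt (d : ℕ) : Type := EuclideanSpace ℝ (Fin d)

/-- A bounded Lipschitz domain: a bounded, connected, nonempty open set which, near each of its
boundary points, lies below the graph of a Lipschitz function. The graph is taken over the
hyperplane orthogonal to a unit vector `ν`, onto which `y` projects as `y - ⟪ν, y⟫ ν`. -/
def IsBoundedLipschitzDomain {d : ℕ} (Ω : Set (Pt d)) : Prop :=
  IsOpen Ω ∧ IsConnected Ω ∧ Bornology.IsBounded Ω ∧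
    ∀ x ∈ frontier Ω, ∃ (ν : Pt d) (r : ℝ) (K : NNReal) (γ : Pt d → ℝ),
      ‖ν‖ = 1 ∧ 0 < r ∧ LipschitzWith K γ ∧
        ∀ y ∈ Metric.ball x r, y ∈ Ω ↔ inner ℝ ν y < γ (y - (inner ℝ ν y) • ν)

/-- The parts of `∂Ω` on which boundary conditions are prescribed: relatively open subsets. -/
def IsBoundaryPart {d : ℕ} (Ω Γ : Set (Pt d)) : Prop :=
  ∃ O : Set (Pt d), IsOpen O ∧ Γ = O ∩ frontier Ω

/-! ### Function spaces -/

/-- The Hilbert space `L²(Ω)`. -/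
abbrev L2 {d : ℕ} (Ω : Set (Pt d)) : Type := Lp ℝ 2 (volume.restrict Ω)

/-- The classical partial derivative `∂_j φ`. -/
def pderiv {d : ℕ} (j : Fin d) (φ : Pt d → ℝ) (x : Pt d) : ℝ :=
  fderiv ℝ φ x (EuclideanSpace.single j 1)

/-- Test functions: elements of `C_c^∞(ℝ^d)`. -/
def IsTestFunction {d : ℕ} (φ : Pt d → ℝ) : Prop :=
  ContDiff ℝ ∞ φ ∧ HasCompactSupport φ

/-- Ambient space for displacements. The pair `(u, G)` represents a vector field `u ∈ H¹(Ω)^d`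
together with its weak gradient `G i j = ∂_j u_i`, which is uniquely determined by `u`. -/
abbrev Disp {d : ℕ} (Ω : Set (Pt d)) : Type := (Fin d → L2 Ω) × (Fin d → Fin d → L2 Ω)

/-- Ambient space for fluxes. The pair `(v, δ)` represents a vector field `v ∈ H(div, Ω)` together with its weak divergence
`δ = div v`, which is uniquely determined by `v`. -/
abbrev Flux {d : ℕ} (Ω : Set (Pt d)) : Type := (Fin d → L2 Ω) × L2 Ω

/-- `g` is the weak derivative `∂_j f` on `Ω`. -/
def HasWeakPartial {d : ℕ} (Ω : Set (Pt d)) (j : Fin d) (f g : L2 Ω) : Prop :=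
  ∀ φ : Pt d → ℝ, IsTestFunction φ → tsupport φ ⊆ Ω →
    ∫ x in Ω, f x * pderiv j φ x = -∫ x in Ω, g x * φ x

/-- For `f ∈ H¹(Ω)` with weak gradient `G`: the trace of `f` vanishes on the relatively open part
`Γ` of `∂Ω`. As `∫_Ω (f ∂_jφ + φ ∂_j f) = ∫_{∂Ω} f φ n_j` for test functions `φ`, this says that the
right-hand side vanishes for all `j` and all `φ` whose support meets `∂Ω` only inside `Γ`. -/
def TraceVanishes {d : ℕ} (Ω Γ : Set (Pt d)) (f : L2 Ω) (G : Fin d → L2 Ω) : Prop :=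
  ∀ (j : Fin d) (φ : Pt d → ℝ), IsTestFunction φ → Disjoint (tsupport φ) (frontier Ω \ Γ) →
    ∫ x in Ω, f x * pderiv j φ x = -∫ x in Ω, G j x * φ x

/-- `δ` is the weak divergence of `v` on `Ω`. -/
def HasWeakDiv {d : ℕ} (Ω : Set (Pt d)) (v : Fin d → L2 Ω) (δ : L2 Ω) : Prop :=
  ∀ φ : Pt d → ℝ, IsTestFunction φ → tsupport φ ⊆ Ω →
    ∫ x in Ω, ∑ k, v k x * pderiv k φ x = -∫ x in Ω, δ x * φ x

/-- For `v ∈ H(div, Ω)` with weak divergence `δ`: the normal trace `v · n` vanishes on the relatively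
open part `Γ` of `∂Ω`, that is, `⟨v · n, φ⟩ = ∫_Ω (v · ∇φ + φ div v) = 0` for all test functions `φ`
whose support meets `∂Ω` only inside `Γ`. -/
def NormalTraceVanishes {d : ℕ} (Ω Γ : Set (Pt d)) (v : Fin d → L2 Ω) (δ : L2 Ω) : Prop :=
  ∀ φ : Pt d → ℝ, IsTestFunction φ → Disjoint (tsupport φ) (frontier Ω \ Γ) →
    ∫ x in Ω, ∑ k, v k x * pderiv k φ x = -∫ x in Ω, δ x * φ x

/-- The displacement space `U = {u ∈ H¹(Ω)^d : u = 0 on ΓuD}`. -/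
def dispSpace {d : ℕ} (Ω ΓuD : Set (Pt d)) : Set (Disp Ω) :=
  {u | ∀ i, (∀ j, HasWeakPartial Ω j (u.1 i) (u.2 i j)) ∧ TraceVanishes Ω ΓuD (u.1 i) (u.2 i)}

/-- The flux space `V_i = {v ∈ H(div, Ω) : v · n = 0 on ΓpN}`. -/
def fluxSpace {d : ℕ} (Ω ΓpN : Set (Pt d)) : Set (Flux Ω) :=
  {v | HasWeakDiv Ω v.1 v.2 ∧ NormalTraceVanishes Ω ΓpN v.1 v.2}

/-- The pressure space `P_i`, which is `L²(Ω)`, or `L²_0(Ω)` (mean value zero) if `ΓuD = ∂Ω`. -/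
def pressureSpace {d : ℕ} (Ω ΓuD : Set (Pt d)) : Set (L2 Ω) :=
  {q | ΓuD = frontier Ω → ∫ x in Ω, q x = 0}

section Operators

variable {d : ℕ} {Ω : Set (Pt d)}

/-- `div u` for a displacement. -/
def dispDiv (u : Disp Ω) : L2 Ω := ∑ i, u.2 i i

/-- The symmetric gradient `ε(u) = (∇u + (∇u)ᵀ) / 2`. -/
def strain (u : Disp Ω) (i j : Fin d) : L2 Ω := (1 / 2 : ℝ) • (u.2 i j + u.2 j i)

/-- `(ε(u), ε(w))`. -/
def strainInner (u w : Disp Ω) : ℝ := ∑ i, ∑ j, inner ℝ (strain u i j) (strain w i j)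

/-- `‖ε(u)‖`. -/
def strainNorm (u : Disp Ω) : ℝ := √(strainInner u u)

/-- The norm `‖u‖₁` of `H¹(Ω)^d`. -/
def h1Norm (u : Disp Ω) : ℝ := √(∑ i, ‖u.1 i‖ ^ 2 + ∑ i, ∑ j, ‖u.2 i j‖ ^ 2)

/-- `div v` for a flux. -/
def fluxDiv (v : Flux Ω) : L2 Ω := v.2

/-- The `L²` inner product of two flux fields. -/
def fluxInner (v z : Flux Ω) : ℝ := ∑ k, inner ℝ (v.1 k) (z.1 k)

/-- The norm of `H(div, Ω)`. -/
def divNorm (v : Flux Ω) : ℝ := √(fluxInner v v + ‖fluxDiv v‖ ^ 2)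

end Operators

/-! ### Inf-sup conditions -/

/-- `inf_{q ∈ P_i} sup_{v ∈ V_i} (div v, q) / (‖v‖_div ‖q‖) ≥ β`. -/
def FluxInfSup {d : ℕ} (Ω ΓuD ΓpN : Set (Pt d)) (β : ℝ) : Prop :=
  ∀ q ∈ pressureSpace Ω ΓuD, q ≠ 0 →
    β ≤ ⨆ v : {v : Flux Ω // v ∈ fluxSpace Ω ΓpN ∧ v ≠ 0},
      inner ℝ (fluxDiv v.1) q / (divNorm v.1 * ‖q‖)

/-- `inf_q sup_{u ∈ U} (div u, q) / (‖u‖₁ ‖q‖) ≥ β`. As all the spaces `P_i` coincide, the infimum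
over the sums `q = q_1 + ⋯ + q_n` with `q_i ∈ P_i` is the infimum over `q ∈ P_i`. -/
def DispInfSup {d : ℕ} (Ω ΓuD : Set (Pt d)) (β : ℝ) : Prop :=
  ∀ q ∈ pressureSpace Ω ΓuD, q ≠ 0 →
    β ≤ ⨆ u : {u : Disp Ω // u ∈ dispSpace Ω ΓuD ∧ u ≠ 0},
      inner ℝ (dispDiv u.1) q / (h1Norm u.1 * ‖q‖)

/-! ### Parameters of the model -/

/-- The physical parameters of the model with `n` networks and the time step size, in the ranges
assumed for them. -/
structure Params (n : ℕ) where
  /-- the (scaled) Lamé parameter -/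
  lam : ℝ
  /-- the time step size -/
  tau : ℝ
  /-- the hydraulic conductivities -/
  K : Fin n → ℝ
  /-- the Biot-Willis parameters -/
  alpha : Fin n → ℝ
  /-- the constrained specific storage coefficients -/
  cp : Fin n → ℝ
  /-- the network transfer coefficients; only the values `beta i j` with `i ≠ j` are used -/
  beta : Fin n → Fin n → ℝ
  lam_pos : 0 < lam
  tau_pos : 0 < tau
  K_pos : ∀ i, 0 < K i
  alpha_pos : ∀ i, 0 < alpha i
  cp_nonneg : ∀ i, 0 ≤ cp i
  beta_nonneg : ∀ i j, i ≠ j → 0 ≤ beta i j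
  beta_symm : ∀ i j, beta i j = beta j i

namespace Params

variable {n : ℕ} (P : Params n)

/-- `R_i⁻¹ = τ⁻¹ K_i⁻¹ α_i²`. -/
def Rinv (i : Fin n) : ℝ := P.tau⁻¹ * (P.K i)⁻¹ * P.alpha i ^ 2

/-- `R`, where `R⁻¹ = max {R_1⁻¹, …, R_n⁻¹}`. -/
def R : ℝ := (⨆ i, P.Rinv i)⁻¹

/-- `α_{p_i} = c_{p_i} / α_i²`. -/
def alphaP (i : Fin n) : ℝ := P.cp i / P.alpha i ^ 2

/-- `β_ij`, where `β_ii = ∑_{j ≠ i} β_ij`. -/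
def betaFull (i j : Fin n) : ℝ :=
  if i = j then ∑ k ∈ Finset.univ.erase i, P.beta i k else P.beta i j

/-- `α_ij = τ β_ij / (α_i α_j)`. -/
def alphaC (i j : Fin n) : ℝ := P.tau * P.betaFull i j / (P.alpha i * P.alpha j)

/-- `λ_0 = max {1, λ}`. -/
def lam0 : ℝ := max 1 P.lam

/-- `Λ_1`: diagonal entries `α_ii`, off-diagonal entries `-α_ij`. -/
def Lambda1 : Matrix (Fin n) (Fin n) ℝ :=
  Matrix.of fun i j => if i = j then P.alphaC i i else -P.alphaC i j

/-- `Λ_2 = diag(α_{p_1}, …, α_{p_n})`. -/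
def Lambda2 : Matrix (Fin n) (Fin n) ℝ := Matrix.diagonal P.alphaP

/-- `Λ_3 = diag(R, …, R)`. -/
def Lambda3 : Matrix (Fin n) (Fin n) ℝ := Matrix.diagonal fun _ => P.R

/-- `Λ_4`: all entries `1 / λ_0`. -/
def Lambda4 : Matrix (Fin n) (Fin n) ℝ := Matrix.of fun _ _ => 1 / P.lam0

/-- `Λ = Λ_1 + Λ_2 + Λ_3 + Λ_4`. -/
def Lambda : Matrix (Fin n) (Fin n) ℝ := P.Lambda1 + P.Lambda2 + P.Lambda3 + P.Lambda4

/-- `Λ_e = Λ + Λ_L`, where all entries of `Λ_L` are `L`. -/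
def LambdaE (L : ℝ) : Matrix (Fin n) (Fin n) ℝ := P.Lambda + Matrix.of fun _ _ => L

end Params

/-! ### The variational problem and the iteration -/

/-- A triple `(u; v; p)` of a displacement, `n` fluxes and `n` pressures. -/
@[ext]
structure State (n : ℕ) {d : ℕ} (Ω : Set (Pt d)) where
  u : Disp Ω
  v : Fin n → Flux Ω
  p : Fin n → L2 Ω

section Problem

variable {n d : ℕ} {Ω : Set (Pt d)}

/-- `(u; v; p) ∈ U × V × P`. -/
def State.Mem (ΓuD : Set (Pt d)) (ΓpN : Fin n → Set (Pt d)) (s : State n Ω) : Prop :=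
  s.u ∈ dispSpace Ω ΓuD ∧ (∀ i, s.v i ∈ fluxSpace Ω (ΓpN i)) ∧ ∀ i, s.p i ∈ pressureSpace Ω ΓuD

/-- The mechanics equation for `u` with given pressures `p`:
`(ε(u), ε(w)) + λ (div u, div w) - ∑_i (p_i, div w) = (f, w)` for all `w ∈ U`. -/
def MechanicsEq (P : Params n) (ΓuD : Set (Pt d)) (f : Fin d → L2 Ω) (u : Disp Ω)
    (p : Fin n → L2 Ω) : Prop :=
  ∀ w ∈ dispSpace Ω ΓuD,
    strainInner u w + P.lam * inner ℝ (dispDiv u) (dispDiv w) - ∑ i, inner ℝ (p i) (dispDiv w)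
      = ∑ k, inner ℝ (f k) (w.1 k)

/-- `(R_i⁻¹ v_i, z_i) - (p_i, div z_i) = 0` for all `z_i ∈ V_i`, `i = 1, …, n`. -/
def DarcyEq (P : Params n) (ΓpN : Fin n → Set (Pt d)) (v : Fin n → Flux Ω)
    (p : Fin n → L2 Ω) : Prop :=
  ∀ i, ∀ z ∈ fluxSpace Ω (ΓpN i), P.Rinv i * fluxInner (v i) z - inner ℝ (p i) (fluxDiv z) = 0

/-- `s = (u; v; p)` is a weak solution of the static problem with right-hand sides `f`, `g`. -/
def IsWeakSolution (P : Params n) (ΓuD : Set (Pt d)) (ΓpN : Fin n → Set (Pt d))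
    (f : Fin d → L2 Ω) (g : Fin n → L2 Ω) (s : State n Ω) : Prop :=
  s.Mem ΓuD ΓpN ∧ MechanicsEq P ΓuD f s.u s.p ∧ DarcyEq P ΓpN s.v s.p ∧
    ∀ i, ∀ q ∈ pressureSpace Ω ΓuD,
      -inner ℝ (dispDiv s.u) q - inner ℝ (fluxDiv (s.v i)) q
        + (-P.alphaP i - P.alphaC i i) * inner ℝ (s.p i) q
        + ∑ j ∈ Finset.univ.erase i, P.alphaC i j * inner ℝ (s.p j) q = inner ℝ (g i) q

/-- The flow step: the equations for `v^{m+1}`, `p^{m+1}` (taken from `t`), given `u^m`, `p^m` (taken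
from `s`), with the stabilization parameter `L`. -/
def FlowStep (P : Params n) (L : ℝ) (ΓuD : Set (Pt d)) (ΓpN : Fin n → Set (Pt d))
    (g : Fin n → L2 Ω) (s t : State n Ω) : Prop :=
  (∀ i, ∀ q ∈ pressureSpace Ω ΓuD,
    -inner ℝ (fluxDiv (t.v i)) q - (P.alphaP i + P.alphaC i i) * inner ℝ (t.p i) q
        + ∑ j ∈ Finset.univ.erase i, P.alphaC i j * inner ℝ (t.p j) q
        - L * inner ℝ (∑ j, t.p j) q
      = inner ℝ (g i) q - L * inner ℝ (∑ j, s.p j) q + inner ℝ (dispDiv s.u) q) ∧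
  DarcyEq P ΓpN t.v t.p

/-- The sequence `x 0, x 1, …` in `U × V × P` is generated by the fixed-stress iteration with
stabilization parameter `L`: in each step, `v^{m+1}` and `p^{m+1}` solve the flow step for given
`u^m`, `p^m`, and then `u^{m+1}` solves the mechanics equation for given `p^{m+1}`. The initial
guess is arbitrary. -/
def IsFixedStressIteration (P : Params n) (L : ℝ) (ΓuD : Set (Pt d)) (ΓpN : Fin n → Set (Pt d))
    (f : Fin d → L2 Ω) (g : Fin n → L2 Ω) (x : ℕ → State n Ω) : Prop :=
  ∀ m, (x m).Mem ΓuD ΓpN ∧ FlowStep P L ΓuD ΓpN g (x m) (x (m + 1)) ∧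
    MechanicsEq P ΓuD f (x (m + 1)).u (x (m + 1)).p

/-- The error `(e_u; e_v; e_p)` of `t` as an approximation of `s`. -/
def State.error (s t : State n Ω) : State n Ω := ⟨t.u - s.u, t.v - s.v, t.p - s.p⟩

/-! ### Norms and the rate -/

/-- `‖u‖_U`, where `‖u‖_U² = (ε(u), ε(u)) + λ (div u, div u)`. -/
def normU (P : Params n) (u : Disp Ω) : ℝ :=
  √(strainInner u u + P.lam * inner ℝ (dispDiv u) (dispDiv u))

/-- `‖v‖_{V_e}`, where `‖v‖_{V_e}² = ∑_i (R_i⁻¹ v_i, v_i) + (Λ_e⁻¹ Div v, Div v)`. -/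
def normVe (P : Params n) (L : ℝ) (v : Fin n → Flux Ω) : ℝ :=
  √(∑ i, P.Rinv i * fluxInner (v i) (v i)
    + ∑ i, ∑ j, (P.LambdaE L)⁻¹ i j * inner ℝ (fluxDiv (v j)) (fluxDiv (v i)))

/-- `‖p‖_{P_e}`, where `‖p‖_{P_e}² = (Λ_e p, p)`. -/
def normPe (P : Params n) (L : ℝ) (p : Fin n → L2 Ω) : ℝ :=
  √(∑ i, ∑ j, P.LambdaE L i j * inner ℝ (p j) (p i))

end Problem

/-- The convergence rate, `rate² = 1 / (L⁻¹ / (β_s⁻² + λ) + 1)`. -/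
def rate (βs L lam : ℝ) : ℝ := √(1 / (L⁻¹ / ((βs ^ 2)⁻¹ + lam) + 1))

end MPET

end

open MPET

/-!
The operator `S : σ ↦ div u`, where `u` solves the homogeneous mechanics equation with total pressure
`σ`, is symmetric on the pressure space, `(S σ, σ) = ‖u‖_U²`, and satisfies
`(β_s⁻² + λ)⁻¹ ≤ S ≤ (λ + c_K²)⁻¹ ≤ L`. The upper bound
(`ErrorMechanics.mul_norm_energyMap_sq_le`) is the assumed estimate of `div` by `ε`. The lower bound
(`ErrorMechanics.norm_sq_le`) comes from a test function `w` with `div w = σ` and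
`‖w‖₁ ≤ β_s⁻¹ ‖σ‖`; it exists because, by the inf-sup condition, the adjoint of
`div : U → P` is bounded below (`DispInfSup.exists_dispDiv_eq`). This uses that `U` is complete, and
that `div` maps `U` into the pressure space also when the pressures have mean value zero.

For total pressure errors `σ`, `σ'` in consecutive steps, the flow equations tested with the errors
themselves (`ErrorFlow.energy`) give `L ‖σ'‖² ≤ (L σ - S σ, σ')`. As `L - S` is positive semidefinite,
the right-hand side is at most half the sum of the values of its quadratic form at `σ` and `σ'`, and
with `μ = (β_s⁻² + λ)⁻¹` this becomes `(L + μ) ‖σ'‖² ≤ L ‖σ‖²`, which is the contraction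
(`ErrorMechanics.norm_le_rate_mul`).

With `r = L σ - div u` the residual of a step, the energy identity also yields
`‖v‖_{V_e} + ‖p‖_{P_e} ≤ C ‖r‖ / √L` (`ErrorFlow.normVe_add_normPe_le`): the `R`-part of the pressure
norm is bounded by the inf-sup condition for the fluxes, the `Λ_4`-part by `1 / λ_0 ≤ (1 + c_K²) L`,
and the `Λ_e⁻¹`-part of the flux norm by testing with `Λ_e⁻¹ Div v`. For an arbitrary initial guess
the equation for `S` is not available in step `0`, so the geometric decay starts at step `1`;
the lost power of the rate is absorbed in the constants because the rate is bounded below in terms of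
`c_K` and `β_s` alone (`one_le_mul_rate_sq`).
-/

noncomputable section

namespace MPET

open MeasureTheory
open scoped ContDiff

/-! ### Function spaces as closed subspaces -/

section Spaces

variable {d : ℕ} {Ω : Set (Pt d)}

theorem IsTestFunction.continuous_pderiv {φ : Pt d → ℝ} (hφ : IsTestFunction φ) (j : Fin d) :
    Continuous (pderiv j φ) :=
  (hφ.1.continuous_fderiv (by simp)).clm_apply continuous_const

theorem IsTestFunction.hasCompactSupport_pderiv {φ : Pt d → ℝ} (hφ : IsTestFunction φ)
    (j : Fin d) : HasCompactSupport (pderiv j φ) :=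
  hφ.2.fderiv_apply ℝ _

/-- Integration over `Ω` against a continuous, compactly supported function is a continuous linear
functional on `L²(Ω)`. -/
theorem exists_clm_integral_mul (Ω : Set (Pt d)) {ψ : Pt d → ℝ} (hψ : Continuous ψ)
    (hψc : HasCompactSupport ψ) :
    ∃ T : L2 Ω →L[ℝ] ℝ, ∀ f : L2 Ω,
      Integrable (fun x => f x * ψ x) (volume.restrict Ω) ∧ ∫ x in Ω, f x * ψ x = T f := by
  have hmem : MemLp ψ 2 (volume.restrict Ω) := hψ.memLp_of_hasCompactSupport hψc
  refine ⟨innerSL ℝ (hmem.toLp ψ), fun f => ⟨?_, ?_⟩⟩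
  · exact (Lp.memLp f).integrable_mul hmem
  · rw [innerSL_apply_apply, L2.inner_def]
    refine integral_congr_ae ?_
    filter_upwards [hmem.coeFn_toLp] with x hx
    simp [hx]

theorem exists_clm_partial (Ω : Set (Pt d)) {φ : Pt d → ℝ} (hφ : IsTestFunction φ) (j : Fin d) :
    ∃ T : L2 Ω × L2 Ω →L[ℝ] ℝ, ∀ f g : L2 Ω,
      (∫ x in Ω, f x * pderiv j φ x = -∫ x in Ω, g x * φ x) ↔ T (f, g) = 0 := by
  obtain ⟨A, hA⟩ := exists_clm_integral_mul Ω (hφ.continuous_pderiv j)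
    (hφ.hasCompactSupport_pderiv j)
  obtain ⟨B, hB⟩ := exists_clm_integral_mul Ω hφ.1.continuous hφ.2
  refine ⟨A.coprod B, fun f g => ?_⟩
  rw [(hA f).2, (hB g).2, ContinuousLinearMap.coprod_apply, eq_neg_iff_add_eq_zero]

theorem exists_clm_div (Ω : Set (Pt d)) {φ : Pt d → ℝ} (hφ : IsTestFunction φ) :
    ∃ T : Flux Ω →L[ℝ] ℝ, ∀ v : Flux Ω,
      (∫ x in Ω, ∑ k, v.1 k x * pderiv k φ x = -∫ x in Ω, v.2 x * φ x) ↔ T v = 0 := by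
  choose A hA using fun k => exists_clm_integral_mul Ω (hφ.continuous_pderiv k)
    (hφ.hasCompactSupport_pderiv k)
  obtain ⟨B, hB⟩ := exists_clm_integral_mul Ω hφ.1.continuous hφ.2
  refine ⟨(∑ k, (A k).comp (ContinuousLinearMap.proj k)).coprod B, fun v => ?_⟩
  rw [integral_finsetSum _ fun k _ => (hA k (v.1 k)).1, (hB v.2).2,
    ContinuousLinearMap.coprod_apply, eq_neg_iff_add_eq_zero]
  simp [hA]

/-- A set of the form `{x | ∀ i, p i → T i x = 0}` with continuous linear functionals `T i` is the
carrier of a closed subspace. -/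
theorem exists_submodule_of_functionals {E ι : Type*} [AddCommGroup E] [Module ℝ E]
    [TopologicalSpace E] (s : Set E)
    (p : ι → Prop) (Q : ι → E → Prop)
    (hQ : ∀ i, p i → ∃ T : E →L[ℝ] ℝ, ∀ x, Q i x ↔ T x = 0)
    (hs : ∀ x, x ∈ s ↔ ∀ i, p i → Q i x) :
    ∃ S : Submodule ℝ E, (S : Set E) = s ∧ IsClosed s := by
  choose T hT using hQ
  have hs' : s = ((⨅ i, ⨅ h : p i, (T i h).ker : Submodule ℝ E) : Set E) := by
    ext x
    simp only [hs, SetLike.mem_coe, Submodule.mem_iInf, LinearMap.mem_ker,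
      ContinuousLinearMap.coe_coe]
    exact forall₂_congr fun i h => hT i h x
  refine ⟨_, hs'.symm, ?_⟩
  have : s = ⋂ i, ⋂ h : p i, (T i h) ⁻¹' {0} := by
    ext x
    simp only [hs, Set.mem_iInter, Set.mem_preimage, Set.mem_singleton_iff]
    exact forall₂_congr fun i h => hT i h x
  rw [this]
  exact isClosed_iInter fun i => isClosed_iInter fun h =>
    isClosed_singleton.preimage (T i h).continuous

theorem dispSpace_eq_submodule (Ω ΓuD : Set (Pt d)) :
    ∃ S : Submodule ℝ (Disp Ω), (S : Set (Disp Ω)) = dispSpace Ω ΓuD ∧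
      IsClosed (dispSpace Ω ΓuD) := by
  refine exists_submodule_of_functionals (ι := Fin d × Fin d × (Pt d → ℝ)) _
    (fun i => IsTestFunction i.2.2 ∧
      (tsupport i.2.2 ⊆ Ω ∨ Disjoint (tsupport i.2.2) (frontier Ω \ ΓuD)))
    (fun i u => ∫ x in Ω, u.1 i.1 x * pderiv i.2.1 i.2.2 x
      = -∫ x in Ω, u.2 i.1 i.2.1 x * i.2.2 x) ?_ ?_
  · rintro ⟨i, j, φ⟩ ⟨hφ, -⟩
    obtain ⟨T, hT⟩ := exists_clm_partial Ω hφ j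
    exact ⟨T.comp (((ContinuousLinearMap.proj i).comp (ContinuousLinearMap.fst ℝ _ _)).prod
      ((ContinuousLinearMap.proj j).comp ((ContinuousLinearMap.proj i).comp
        (ContinuousLinearMap.snd ℝ (Fin d → L2 Ω) (Fin d → Fin d → L2 Ω))))), fun u => hT _ _⟩
  · intro u
    constructor
    · rintro h ⟨i, j, φ⟩ ⟨hφ, h1 | h1⟩
      · exact (h i).1 j φ hφ h1
      · exact (h i).2 j φ hφ h1
    · exact fun h i => ⟨fun j φ hφ h1 => h (i, j, φ) ⟨hφ, .inl h1⟩,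
        fun j φ hφ h1 => h (i, j, φ) ⟨hφ, .inr h1⟩⟩

theorem fluxSpace_eq_submodule (Ω ΓpN : Set (Pt d)) :
    ∃ S : Submodule ℝ (Flux Ω), (S : Set (Flux Ω)) = fluxSpace Ω ΓpN ∧
      IsClosed (fluxSpace Ω ΓpN) := by
  refine exists_submodule_of_functionals (ι := Pt d → ℝ) _
    (fun φ => IsTestFunction φ ∧ (tsupport φ ⊆ Ω ∨ Disjoint (tsupport φ) (frontier Ω \ ΓpN)))
    (fun φ v => ∫ x in Ω, ∑ k, v.1 k x * pderiv k φ x = -∫ x in Ω, v.2 x * φ x) ?_ ?_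
  · rintro φ ⟨hφ, -⟩
    exact exists_clm_div Ω hφ
  · intro u
    constructor
    · rintro h φ ⟨hφ, h1 | h1⟩
      · exact h.1 φ hφ h1
      · exact h.2 φ hφ h1
    · exact fun h => ⟨fun φ hφ h1 => h φ ⟨hφ, .inl h1⟩, fun φ hφ h1 => h φ ⟨hφ, .inr h1⟩⟩

/-- A test function that equals `1` on a neighbourhood of each point of the bounded set `Ω`. -/
theorem exists_cutoff (hΩ : Bornology.IsBounded Ω) :
    ∃ φ : Pt d → ℝ, IsTestFunction φ ∧ (∀ x ∈ Ω, φ x = 1) ∧ ∀ x ∈ Ω, ∀ j, pderiv j φ x = 0 := by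
  obtain ⟨r, hr0, hr⟩ := hΩ.subset_ball_lt 0 0
  let b : ContDiffBump (0 : Pt d) := ⟨r, r + 1, hr0, by linarith⟩
  refine ⟨b, ⟨b.contDiff, b.hasCompactSupport⟩, fun x hx => ?_, fun x hx j => ?_⟩
  · exact b.one_of_mem_closedBall (Metric.ball_subset_closedBall (hr hx))
  · have h := (b.eventuallyEq_one_of_mem_ball (hr hx)).fderiv_eq (𝕜 := ℝ)
    have h1 : fderiv ℝ (1 : Pt d → ℝ) x = 0 := fderiv_const_apply 1
    rw [pderiv, h, h1]
    rfl

/-- If the trace of `u` vanishes on the whole boundary, then `div u` has mean value zero. -/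
theorem dispDiv_mem_pressureSpace {ΓuD : Set (Pt d)} (hΩm : MeasurableSet Ω)
    (hΩ : Bornology.IsBounded Ω) {u : Disp Ω} (hu : u ∈ dispSpace Ω ΓuD) :
    dispDiv u ∈ pressureSpace Ω ΓuD := by
  intro hΓ
  obtain ⟨φ, hφ, h1, h0⟩ := exists_cutoff hΩ
  obtain ⟨T, hT⟩ := exists_clm_integral_mul Ω hφ.1.continuous hφ.2
  have key : ∀ i, T (u.2 i i) = 0 := by
    intro i
    have h := (hu i).2 i φ hφ (by simp [hΓ])
    rw [setIntegral_congr_fun (g := fun _ => 0) hΩm fun x hx => by simp [h0 x hx], (hT _).2] at h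
    simpa using h
  rw [setIntegral_congr_fun (g := fun x => dispDiv u x * φ x) hΩm fun x hx => by simp [h1 x hx],
    (hT _).2, dispDiv, map_sum]
  exact Finset.sum_eq_zero fun i _ => key i

theorem fluxDiv_mem_pressureSpace {ΓuD ΓpN : Set (Pt d)} (hΩm : MeasurableSet Ω)
    (hΩ : Bornology.IsBounded Ω) (hΓ : ΓuD = frontier Ω → ΓpN = frontier Ω) {v : Flux Ω}
    (hv : v ∈ fluxSpace Ω ΓpN) : fluxDiv v ∈ pressureSpace Ω ΓuD := by
  intro hu
  obtain ⟨φ, hφ, h1, h0⟩ := exists_cutoff hΩ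
  have h := hv.2 φ hφ (by simp [hΓ hu])
  rw [setIntegral_congr_fun (g := fun _ => 0) hΩm fun x hx => by simp [h0 x hx]] at h
  rw [setIntegral_congr_fun (g := fun x => v.2 x * φ x) hΩm fun x hx => by simp [h1 x hx, fluxDiv]]
  simpa using h.symm

theorem pressureSpace_eq_submodule (hΩm : MeasurableSet Ω) (hΩ : Bornology.IsBounded Ω)
    (ΓuD : Set (Pt d)) :
    ∃ S : Submodule ℝ (L2 Ω), (S : Set (L2 Ω)) = pressureSpace Ω ΓuD ∧
      IsClosed (pressureSpace Ω ΓuD) := by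
  refine exists_submodule_of_functionals (ι := Unit) _ (fun _ => ΓuD = frontier Ω)
    (fun _ q => ∫ x in Ω, q x = 0) ?_ (fun q => ⟨fun h _ => h, fun h => h ()⟩)
  intro _ _
  obtain ⟨φ, hφ, h1, -⟩ := exists_cutoff hΩ
  obtain ⟨T, hT⟩ := exists_clm_integral_mul Ω hφ.1.continuous hφ.2
  refine ⟨T, fun q => ?_⟩
  rw [← (hT q).2, setIntegral_congr_fun (g := fun x => q x * φ x) hΩm fun x hx => by simp [h1 x hx]]

end Spaces

/-! ### Right inverse of the divergence -/

/-- A bounded operator whose adjoint is bounded below by `β` has a right inverse of norm at most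
`β⁻¹`: the operator `T T†` is coercive, hence invertible, and `w = T† (T T†)⁻¹ σ` solves `T w = σ`. -/
theorem exists_preimage_of_adjoint_bounded_below {H F : Type*} [NormedAddCommGroup H]
    [InnerProductSpace ℝ H] [CompleteSpace H] [NormedAddCommGroup F] [InnerProductSpace ℝ F]
    [CompleteSpace F] (T : H →L[ℝ] F) {β : ℝ} (hβ : 0 < β)
    (h : ∀ q, β * ‖q‖ ≤ ‖T.adjoint q‖) (σ : F) : ∃ w, T w = σ ∧ β * ‖w‖ ≤ ‖σ‖ := by
  have hinner : ∀ q, inner ℝ (T (T.adjoint q)) q = ‖T.adjoint q‖ ^ 2 := fun q => by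
    rw [← ContinuousLinearMap.adjoint_inner_right, real_inner_self_eq_norm_sq]
  have hu : IsUnit (T ∘L T.adjoint) := by
    refine ContinuousLinearMap.isUnit_of_forall_le_norm_inner_map _
      (c := ⟨β ^ 2, by positivity⟩) (by exact_mod_cast (by positivity : 0 < β ^ 2)) fun q => ?_
    rw [ContinuousLinearMap.comp_apply, hinner, Real.norm_of_nonneg (by positivity)]
    calc ‖q‖ ^ 2 * β ^ 2 = (β * ‖q‖) ^ 2 := by ring
      _ ≤ ‖T.adjoint q‖ ^ 2 := by gcongr; exact h q
  obtain ⟨q, hq⟩ := (ContinuousLinearMap.isUnit_iff_bijective.mp hu).2 σ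
  rw [ContinuousLinearMap.comp_apply] at hq
  refine ⟨T.adjoint q, hq, ?_⟩
  have h1 : ‖T.adjoint q‖ ^ 2 ≤ ‖σ‖ * ‖q‖ := by
    rw [← hinner, hq]
    exact real_inner_le_norm _ _
  rcases eq_or_lt_of_le (norm_nonneg (T.adjoint q)) with h0 | h0
  · rw [← h0]; simp
  · refine le_of_mul_le_mul_right ?_ h0
    nlinarith [mul_le_mul_of_nonneg_left (h q) (norm_nonneg σ),
      mul_le_mul_of_nonneg_left h1 hβ.le]

section DispSpace

variable {d : ℕ} {Ω : Set (Pt d)}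

/-- The map from the `ℓ²` product of copies of `L²(Ω)`, indexed by the components of a displacement
and of its gradient, to `Disp Ω`; the Hilbert norm of the source is `h1Norm`. -/
def dispOfPiLp (Ω : Set (Pt d)) : PiLp 2 (fun _ : Fin d ⊕ Fin d × Fin d => L2 Ω) →L[ℝ] Disp Ω :=
  (ContinuousLinearMap.pi fun i => PiLp.proj 2 _ (Sum.inl i)).prod
    (ContinuousLinearMap.pi fun i => ContinuousLinearMap.pi fun j => PiLp.proj 2 _ (Sum.inr (i, j)))

theorem h1Norm_dispOfPiLp (x : PiLp 2 (fun _ : Fin d ⊕ Fin d × Fin d => L2 Ω)) :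
    h1Norm (dispOfPiLp Ω x) = ‖x‖ := by
  rw [PiLp.norm_eq_of_L2, h1Norm, Fintype.sum_sum_type, Fintype.sum_prod_type]
  rfl

theorem dispOfPiLp_surjective : Function.Surjective (dispOfPiLp Ω) := fun u =>
  ⟨WithLp.toLp 2 (Sum.elim u.1 fun ij => u.2 ij.1 ij.2), rfl⟩

/-- The divergence as a bounded operator. -/
def dispDivCLM (Ω : Set (Pt d)) : Disp Ω →L[ℝ] L2 Ω :=
  ∑ i, (ContinuousLinearMap.proj i).comp ((ContinuousLinearMap.proj i).comp
        (ContinuousLinearMap.snd ℝ (Fin d → L2 Ω) (Fin d → Fin d → L2 Ω)))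

theorem dispDivCLM_apply (u : Disp Ω) : dispDivCLM Ω u = dispDiv u := by
  simp [dispDivCLM, dispDiv]

/-- A bound `(div u, q) ≤ M ‖u‖₁` on all of `U` and the inf-sup condition give `β ‖q‖ ≤ M`. -/
theorem DispInfSup.mul_norm_le {ΓuD : Set (Pt d)} {β : ℝ} (h : DispInfSup Ω ΓuD β) {q : L2 Ω}
    (hq : q ∈ pressureSpace Ω ΓuD) {M : ℝ} (hM : 0 ≤ M)
    (hb : ∀ u ∈ dispSpace Ω ΓuD, inner ℝ (dispDiv u) q ≤ M * h1Norm u) : β * ‖q‖ ≤ M := by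
  by_cases hq0 : q = 0
  · simpa [hq0] using hM
  · have hqn : 0 < ‖q‖ := norm_pos_iff.mpr hq0
    rw [← le_div_iff₀ hqn]
    refine (h q hq hq0).trans (Real.iSup_le (fun u => ?_) (by positivity))
    refine div_le_of_le_mul₀ (mul_nonneg (Real.sqrt_nonneg _) hqn.le) (by positivity) ?_
    calc _ ≤ M * h1Norm u.1 := hb _ u.2.1
      _ = _ := by field_simp

theorem FluxInfSup.mul_norm_le {ΓuD ΓpN : Set (Pt d)} {β : ℝ} (h : FluxInfSup Ω ΓuD ΓpN β)
    {q : L2 Ω} (hq : q ∈ pressureSpace Ω ΓuD) {M : ℝ} (hM : 0 ≤ M)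
    (hb : ∀ v ∈ fluxSpace Ω ΓpN, inner ℝ (fluxDiv v) q ≤ M * divNorm v) : β * ‖q‖ ≤ M := by
  by_cases hq0 : q = 0
  · simpa [hq0] using hM
  · have hqn : 0 < ‖q‖ := norm_pos_iff.mpr hq0
    rw [← le_div_iff₀ hqn]
    refine (h q hq hq0).trans (Real.iSup_le (fun u => ?_) (by positivity))
    refine div_le_of_le_mul₀ (mul_nonneg (Real.sqrt_nonneg _) hqn.le) (by positivity) ?_
    calc _ ≤ M * divNorm u.1 := hb _ u.2.1
      _ = _ := by field_simp

/-- Under the inf-sup condition the divergence maps `U` onto the pressure space, with a right inverse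
of norm at most `β⁻¹`. -/
theorem DispInfSup.exists_dispDiv_eq {ΓuD : Set (Pt d)} (hΩm : MeasurableSet Ω)
    (hΩ : Bornology.IsBounded Ω) {β : ℝ} (hβ : 0 < β) (h : DispInfSup Ω ΓuD β) {σ : L2 Ω}
    (hσ : σ ∈ pressureSpace Ω ΓuD) :
    ∃ w ∈ dispSpace Ω ΓuD, dispDiv w = σ ∧ β * h1Norm w ≤ ‖σ‖ := by
  obtain ⟨S, hS, hSc⟩ := dispSpace_eq_submodule Ω ΓuD
  obtain ⟨F, hF, hFc⟩ := pressureSpace_eq_submodule hΩm hΩ ΓuD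
  have hSmem : ∀ u, u ∈ S ↔ u ∈ dispSpace Ω ΓuD := fun u => by rw [← hS]; rfl
  have hFmem : ∀ q, q ∈ F ↔ q ∈ pressureSpace Ω ΓuD := fun u => by rw [← hF]; rfl
  let H : Submodule ℝ (PiLp 2 (fun _ : Fin d ⊕ Fin d × Fin d => L2 Ω)) :=
    S.comap (dispOfPiLp Ω : _ →ₗ[ℝ] Disp Ω)
  have hH : ∀ x : H, dispOfPiLp Ω x ∈ dispSpace Ω ΓuD := fun x => (hSmem _).mp x.2
  have hHc : IsClosed (H : Set (PiLp 2 (fun _ : Fin d ⊕ Fin d × Fin d => L2 Ω))) := by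
    have := hSc.preimage (dispOfPiLp Ω).continuous
    rwa [← hS] at this
  have : CompleteSpace H := hHc.completeSpace_coe
  have : CompleteSpace F := by rw [← hF] at hFc; exact hFc.completeSpace_coe
  let T : H →L[ℝ] F := ((dispDivCLM Ω).comp ((dispOfPiLp Ω).comp H.subtypeL)).codRestrict F
    fun x => (hFmem _).mpr (by
      simpa [dispDivCLM_apply] using dispDiv_mem_pressureSpace hΩm hΩ (hH x))
  have hT : ∀ x : H, (T x : L2 Ω) = dispDiv (dispOfPiLp Ω x) := fun x => by
    simp [T, dispDivCLM_apply]
  obtain ⟨w, hw, hwn⟩ := exists_preimage_of_adjoint_bounded_below T hβ (fun q => by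
    refine h.mul_norm_le ((hFmem _).mp q.2) (norm_nonneg _) fun u hu => ?_
    obtain ⟨x, rfl⟩ := dispOfPiLp_surjective u
    have hx : x ∈ H := (hSmem _).mpr hu
    rw [h1Norm_dispOfPiLp, ← hT ⟨x, hx⟩, ← Submodule.coe_inner, real_inner_comm,
      ← ContinuousLinearMap.adjoint_inner_left]
    exact real_inner_le_norm _ _) ⟨σ, (hFmem _).mpr hσ⟩
  refine ⟨_, hH w, by rw [← hT, hw], ?_⟩
  rw [h1Norm_dispOfPiLp]
  exact hwn

end DispSpace

/-! ### Energy inner products and norms -/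

section Energy

variable {n d : ℕ} {Ω : Set (Pt d)}

/-- The entries of `ε(u)` together with `√λ div u`, as a linear map into a Hilbert space. It turns
the bilinear form `(ε(u), ε(w)) + λ (div u, div w)` into an inner product and `‖u‖_U` into a norm. -/
def energyMap (P : Params n) (Ω : Set (Pt d)) :
    Disp Ω →ₗ[ℝ] PiLp 2 (fun _ : Fin d × Fin d ⊕ Unit => L2 Ω) where
  toFun u := WithLp.toLp 2 (Sum.elim (fun ij => strain u ij.1 ij.2) fun _ => √P.lam • dispDiv u)
  map_add' u w := by
    ext1 i
    rcases i with ij | _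
    · simp only [strain, PiLp.add_apply, Sum.elim_inl, Prod.snd_add, Pi.add_apply]
      module
    · simp [dispDiv, Finset.sum_add_distrib]
  map_smul' c u := by
    ext1 i
    rcases i with ij | _
    · simp only [strain, PiLp.smul_apply, Sum.elim_inl, Prod.smul_snd, Pi.smul_apply,
        RingHom.id_apply]
      module
    · simp [dispDiv, ← Finset.smul_sum, smul_comm c]

theorem inner_energyMap (P : Params n) (u w : Disp Ω) :
    inner ℝ (energyMap P Ω u) (energyMap P Ω w)
      = strainInner u w + P.lam * inner ℝ (dispDiv u) (dispDiv w) := by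
  have := Real.mul_self_sqrt P.lam_pos.le
  simp [energyMap, PiLp.inner_apply, Fintype.sum_prod_type, strainInner, inner_smul_left,
    inner_smul_right, ← mul_assoc, this]

theorem normU_eq (P : Params n) (u : Disp Ω) : normU P u = ‖energyMap P Ω u‖ := by
  rw [normU, ← inner_energyMap, real_inner_self_eq_norm_sq, Real.sqrt_sq (norm_nonneg _)]

theorem norm_energyMap_sq (P : Params n) (u : Disp Ω) :
    ‖energyMap P Ω u‖ ^ 2 = strainNorm u ^ 2 + P.lam * ‖dispDiv u‖ ^ 2 := by
  rw [← real_inner_self_eq_norm_sq, inner_energyMap, real_inner_self_eq_norm_sq, strainNorm,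
    Real.sq_sqrt]
  exact Finset.sum_nonneg fun i _ => Finset.sum_nonneg fun j _ => real_inner_self_nonneg

theorem strainNorm_le_h1Norm (u : Disp Ω) : strainNorm u ≤ h1Norm u := by
  refine Real.sqrt_le_sqrt ?_
  have h1 : strainInner u u ≤ ∑ i, ∑ j, (‖u.2 i j‖ ^ 2 + ‖u.2 j i‖ ^ 2) / 2 := by
    refine Finset.sum_le_sum fun i _ => Finset.sum_le_sum fun j _ => ?_
    rw [real_inner_self_eq_norm_sq, strain, norm_smul, mul_pow]
    have := parallelogram_law_with_norm ℝ (u.2 i j) (u.2 j i)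
    have h2 : ‖(1 / 2 : ℝ)‖ ^ 2 = 1 / 4 := by norm_num
    rw [h2]
    nlinarith [mul_self_nonneg ‖u.2 i j - u.2 j i‖]
  have h2 : ∑ i, ∑ j, (‖u.2 i j‖ ^ 2 + ‖u.2 j i‖ ^ 2) / 2 = ∑ i, ∑ j, ‖u.2 i j‖ ^ 2 := by
    simp only [← Finset.sum_div, Finset.sum_add_distrib]
    rw [Finset.sum_comm (f := fun i j => ‖u.2 j i‖ ^ 2)]
    ring
  rw [h2] at h1
  have : 0 ≤ ∑ i, ‖u.1 i‖ ^ 2 := by positivity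
  linarith

/-- The `L²` components of a flux as an element of a Hilbert space with inner product
`fluxInner`. -/
def fluxVec (v : Flux Ω) : PiLp 2 (fun _ : Fin d => L2 Ω) := WithLp.toLp 2 v.1

theorem inner_fluxVec (v z : Flux Ω) : inner ℝ (fluxVec v) (fluxVec z) = fluxInner v z := by
  simp [fluxVec, PiLp.inner_apply, fluxInner]

theorem norm_fluxVec_sq (v : Flux Ω) : ‖fluxVec v‖ ^ 2 = fluxInner v v := by
  rw [← real_inner_self_eq_norm_sq, inner_fluxVec]

theorem norm_fluxVec_le_divNorm (v : Flux Ω) : ‖fluxVec v‖ ≤ divNorm v := by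
  refine Real.le_sqrt_of_sq_le ?_
  rw [norm_fluxVec_sq]
  linarith [sq_nonneg ‖fluxDiv v‖]

end Energy

/-! ### The mechanics equation and the contraction estimate -/

section Mechanics

variable {n d : ℕ} {Ω ΓuD : Set (Pt d)}

/-- The homogeneous mechanics equation `(ε(u), ε(w)) + λ (div u, div w) = (σ, div w)` for all
`w ∈ U`, satisfied by the errors with `σ` the sum of the pressure errors. -/
def ErrorMechanics (P : Params n) (ΓuD : Set (Pt d)) (u : Disp Ω) (σ : L2 Ω) : Prop :=
  ∀ w ∈ dispSpace Ω ΓuD, inner ℝ (energyMap P Ω u) (energyMap P Ω w) = inner ℝ σ (dispDiv w)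

theorem dispSpace_sub_mem {u w : Disp Ω} (hu : u ∈ dispSpace Ω ΓuD) (hw : w ∈ dispSpace Ω ΓuD) :
    u - w ∈ dispSpace Ω ΓuD := by
  obtain ⟨S, hS, -⟩ := dispSpace_eq_submodule Ω ΓuD
  rw [← hS] at hu hw ⊢
  exact S.sub_mem hu hw

theorem fluxSpace_sub_mem {ΓpN : Set (Pt d)} {u w : Flux Ω} (hu : u ∈ fluxSpace Ω ΓpN)
    (hw : w ∈ fluxSpace Ω ΓpN) : u - w ∈ fluxSpace Ω ΓpN := by
  obtain ⟨S, hS, -⟩ := fluxSpace_eq_submodule Ω ΓpN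
  rw [← hS] at hu hw ⊢
  exact S.sub_mem hu hw

theorem ErrorMechanics.sub {P : Params n} {u u' : Disp Ω} {σ σ' : L2 Ω}
    (h : ErrorMechanics P ΓuD u σ) (h' : ErrorMechanics P ΓuD u' σ') :
    ErrorMechanics P ΓuD (u - u') (σ - σ') := fun w hw => by
  rw [map_sub, inner_sub_left, inner_sub_left, h w hw, h' w hw]

theorem MechanicsEq.errorMechanics {P : Params n} {f : Fin d → L2 Ω} {u u' : Disp Ω}
    {p p' : Fin n → L2 Ω} (h : MechanicsEq P ΓuD f u p) (h' : MechanicsEq P ΓuD f u' p') :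
    ErrorMechanics P ΓuD (u - u') (∑ i, (p - p') i) := fun w hw => by
  have h1 := h w hw
  have h2 := h' w hw
  rw [← inner_energyMap] at h1 h2
  simp only [map_sub, inner_sub_left, sum_inner, Pi.sub_apply, Finset.sum_sub_distrib]
  linarith

variable {P : Params n} {cK : ℝ}

theorem mul_norm_dispDiv_sq_le (hcK : 0 < cK)
    (hKorn : ∀ w ∈ dispSpace Ω ΓuD, cK * ‖dispDiv w‖ ≤ strainNorm w) {u : Disp Ω}
    (hu : u ∈ dispSpace Ω ΓuD) :
    (P.lam + cK ^ 2) * ‖dispDiv u‖ ^ 2 ≤ ‖energyMap P Ω u‖ ^ 2 := by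
  rw [norm_energyMap_sq]
  have := pow_le_pow_left₀ (by positivity) (hKorn u hu) 2
  linarith

/-- The upper bound `(S σ, σ) ≤ ‖σ‖² / (λ + c_K²)` for the operator `S σ = div u`. -/
theorem ErrorMechanics.mul_norm_energyMap_sq_le (hcK : 0 < cK)
    (hKorn : ∀ w ∈ dispSpace Ω ΓuD, cK * ‖dispDiv w‖ ≤ strainNorm w) {u : Disp Ω} {σ : L2 Ω}
    (hu : u ∈ dispSpace Ω ΓuD) (h : ErrorMechanics P ΓuD u σ) :
    (P.lam + cK ^ 2) * ‖energyMap P Ω u‖ ^ 2 ≤ ‖σ‖ ^ 2 := by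
  have hlam := P.lam_pos
  have h1 := h u hu
  rw [real_inner_self_eq_norm_sq] at h1
  have h2 := mul_norm_dispDiv_sq_le (P := P) hcK hKorn hu
  have h3 : (0 : ℝ) ≤ ‖σ - (P.lam + cK ^ 2) • dispDiv u‖ ^ 2 := by positivity
  rw [norm_sub_sq_real, inner_smul_right, norm_smul, Real.norm_of_nonneg (by positivity),
    ← h1] at h3
  nlinarith [mul_le_mul_of_nonneg_left h2 (by positivity : 0 ≤ P.lam + cK ^ 2)]

/-- The lower bound `‖σ‖² / (β_s⁻² + λ) ≤ (S σ, σ)` for the operator `S σ = div u`. It is obtained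
by testing with a displacement `w` such that `div w = σ`. -/
theorem ErrorMechanics.norm_sq_le (hΩm : MeasurableSet Ω)
    (hΩ : Bornology.IsBounded Ω) {β : ℝ} (hβ : 0 < β) (hInfSup : DispInfSup Ω ΓuD β)
    {u : Disp Ω} {σ : L2 Ω} (hσ : σ ∈ pressureSpace Ω ΓuD) (h : ErrorMechanics P ΓuD u σ) :
    ‖σ‖ ^ 2 ≤ ((β ^ 2)⁻¹ + P.lam) * ‖energyMap P Ω u‖ ^ 2 := by
  have hlam := P.lam_pos
  obtain ⟨w, hw, hdiv, hwn⟩ := hInfSup.exists_dispDiv_eq hΩm hΩ hβ hσ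
  have h1 := h w hw
  rw [hdiv, real_inner_self_eq_norm_sq] at h1
  have h2 : ‖σ‖ ^ 2 ≤ ‖energyMap P Ω u‖ * ‖energyMap P Ω w‖ := h1 ▸ real_inner_le_norm _ _
  have h3 : ‖energyMap P Ω w‖ ^ 2 ≤ ((β ^ 2)⁻¹ + P.lam) * ‖σ‖ ^ 2 := by
    rw [norm_energyMap_sq, hdiv, add_mul]
    have h4 : β * strainNorm w ≤ ‖σ‖ :=
      (mul_le_mul_of_nonneg_left (strainNorm_le_h1Norm w) hβ.le).trans hwn
    have h5 := pow_le_pow_left₀ (mul_nonneg hβ.le (Real.sqrt_nonneg _)) h4 2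
    rw [mul_pow] at h5
    have h6 : strainNorm w ^ 2 ≤ (β ^ 2)⁻¹ * ‖σ‖ ^ 2 := by
      rwa [inv_mul_eq_div, le_div_iff₀' (by positivity)]
    linarith
  rcases eq_or_lt_of_le (sq_nonneg ‖σ‖) with h0 | h0
  · rw [← h0]; positivity
  · refine le_of_mul_le_mul_right ?_ h0
    calc ‖σ‖ ^ 2 * ‖σ‖ ^ 2 ≤ (‖energyMap P Ω u‖ * ‖energyMap P Ω w‖) ^ 2 := by
          rw [← sq]; exact pow_le_pow_left₀ h0.le h2 2
      _ = ‖energyMap P Ω u‖ ^ 2 * ‖energyMap P Ω w‖ ^ 2 := by ring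
      _ ≤ ‖energyMap P Ω u‖ ^ 2 * (((β ^ 2)⁻¹ + P.lam) * ‖σ‖ ^ 2) := by gcongr
      _ = _ := by ring

theorem rate_sq {β L lam : ℝ} (hβ : 0 < β) (hL : 0 < L) (hlam : 0 < lam) :
    rate β L lam ^ 2 = L / (L + 1 / ((β ^ 2)⁻¹ + lam)) := by
  have : 0 < (β ^ 2)⁻¹ + lam := by positivity
  rw [rate, Real.sq_sqrt (by positivity)]
  field_simp
  ring

/-- The contraction estimate. The symmetric form `B(σ, σ') = L (σ, σ') - (S σ, σ')`, where
`S σ = div u`, is positive semidefinite by the upper bound on `S`, hence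
`2 L ‖σ'‖² ≤ 2 B(σ, σ') ≤ B(σ, σ) + B(σ', σ')`, and the lower bound on `S` applies to the right-hand
side. -/
theorem ErrorMechanics.norm_le_rate_mul (hΩm : MeasurableSet Ω)
    (hΩ : Bornology.IsBounded Ω) {β : ℝ} (hβ : 0 < β) (hInfSup : DispInfSup Ω ΓuD β)
    (hcK : 0 < cK) (hKorn : ∀ w ∈ dispSpace Ω ΓuD, cK * ‖dispDiv w‖ ≤ strainNorm w)
    {L : ℝ} (hL : 1 / (P.lam + cK ^ 2) ≤ L) {u u' : Disp Ω} {σ σ' : L2 Ω}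
    (hu : u ∈ dispSpace Ω ΓuD) (hu' : u' ∈ dispSpace Ω ΓuD)
    (hσ : σ ∈ pressureSpace Ω ΓuD) (hσ' : σ' ∈ pressureSpace Ω ΓuD)
    (h : ErrorMechanics P ΓuD u σ) (h' : ErrorMechanics P ΓuD u' σ')
    (hflow : L * ‖σ'‖ ^ 2 ≤ inner ℝ (L • σ - dispDiv u) σ') :
    ‖σ'‖ ≤ rate β L P.lam * ‖σ‖ := by
  have hlam := P.lam_pos
  have hc : 0 < P.lam + cK ^ 2 := by positivity
  have hL0 : 0 < L := lt_of_lt_of_le (by positivity) hL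
  have hb : 0 < (β ^ 2)⁻¹ + P.lam := by positivity
  have hpsd : ‖energyMap P Ω (u - u')‖ ^ 2 ≤ L * ‖σ - σ'‖ ^ 2 := by
    have h1 := (h.sub h').mul_norm_energyMap_sq_le hcK hKorn (dispSpace_sub_mem hu hu')
    rw [← le_div_iff₀' hc] at h1
    refine h1.trans ?_
    rw [div_eq_inv_mul, ← one_div]
    gcongr
  have hcross := h' u hu
  rw [map_sub, norm_sub_sq_real, norm_sub_sq_real, real_inner_comm, hcross] at hpsd
  rw [inner_sub_left, inner_smul_left, real_inner_comm σ' (dispDiv u)] at hflow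
  have l1 : 1 / ((β ^ 2)⁻¹ + P.lam) * ‖σ‖ ^ 2 ≤ ‖energyMap P Ω u‖ ^ 2 := by
    rw [one_div, inv_mul_le_iff₀ hb]
    exact h.norm_sq_le hΩm hΩ hβ hInfSup hσ
  have l2 : 1 / ((β ^ 2)⁻¹ + P.lam) * ‖σ'‖ ^ 2 ≤ ‖energyMap P Ω u'‖ ^ 2 := by
    rw [one_div, inv_mul_le_iff₀ hb]
    exact h'.norm_sq_le hΩm hΩ hβ hInfSup hσ'
  have hμ : 0 < 1 / ((β ^ 2)⁻¹ + P.lam) := by positivity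
  set μ := 1 / ((β ^ 2)⁻¹ + P.lam) with hμd
  have hmain : (L + μ) * ‖σ'‖ ^ 2 ≤ L * ‖σ‖ ^ 2 := by
    simp only [conj_trivial] at hflow
    nlinarith [mul_nonneg hμ.le (sq_nonneg ‖σ‖)]
  refine le_of_sq_le_sq ?_ (mul_nonneg (Real.sqrt_nonneg _) (norm_nonneg _))
  rw [mul_pow, rate_sq hβ hL0 hlam, ← hμd, div_mul_eq_mul_div, le_div_iff₀' (by positivity)]
  exact hmain

end Mechanics

/-! ### Quadratic forms of the parameter matrices -/

section Forms

variable {n : ℕ} {E : Type*} [NormedAddCommGroup E] [InnerProductSpace ℝ E]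

/-- The bilinear form `(A x, y) = ∑ i j, A i j (x_j, y_i)` on vectors with entries in an inner
product space. -/
def matForm (A : Matrix (Fin n) (Fin n) ℝ) (x y : Fin n → E) : ℝ :=
  ∑ i, ∑ j, A i j * inner ℝ (x j) (y i)

theorem matForm_add (A B : Matrix (Fin n) (Fin n) ℝ) (x y : Fin n → E) :
    matForm (A + B) x y = matForm A x y + matForm B x y := by
  simp [matForm, add_mul, Finset.sum_add_distrib]

theorem matForm_diagonal (a : Fin n → ℝ) (x y : Fin n → E) :
    matForm (Matrix.diagonal a) x y = ∑ i, a i * inner ℝ (x i) (y i) := by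
  simp [matForm, Matrix.diagonal_apply, ite_mul]

theorem matForm_const (c : ℝ) (x y : Fin n → E) :
    matForm (Matrix.of fun _ _ => c) x y = c * inner ℝ (∑ i, x i) (∑ i, y i) := by
  simp only [matForm, Matrix.of_apply, inner_sum, sum_inner, Finset.mul_sum]

theorem matForm_comm {A : Matrix (Fin n) (Fin n) ℝ} (hA : ∀ i j, A i j = A j i)
    (x y : Fin n → E) : matForm A x y = matForm A y x := by
  rw [matForm, Finset.sum_comm]
  refine Finset.sum_congr rfl fun i _ => Finset.sum_congr rfl fun j _ => ?_
  rw [hA j i, real_inner_comm]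

theorem matForm_add_smul_self {A : Matrix (Fin n) (Fin n) ℝ} (hA : ∀ i j, A i j = A j i)
    (x y : Fin n → E) (c : ℝ) :
    matForm A (x + c • y) (x + c • y)
      = matForm A x x + 2 * c * matForm A x y + c ^ 2 * matForm A y y := by
  have h : matForm A (x + c • y) (x + c • y)
      = matForm A x x + c * matForm A x y + c * matForm A y x + c ^ 2 * matForm A y y := by
    simp only [matForm, Finset.mul_sum, ← Finset.sum_add_distrib, Pi.add_apply, Pi.smul_apply,
      inner_add_left, inner_add_right, inner_smul_left, inner_smul_right, conj_trivial]
    refine Finset.sum_congr rfl fun i _ => Finset.sum_congr rfl fun j _ => ?_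
    ring
  rw [h, matForm_comm hA y x]
  ring

namespace Params

variable (P : Params n)

theorem Rinv_pos (i : Fin n) : 0 < P.Rinv i := by
  have := P.tau_pos
  have := P.K_pos i
  have := P.alpha_pos i
  rw [Rinv]; positivity

theorem Rinv_le_iSup (i : Fin n) : P.Rinv i ≤ ⨆ i, P.Rinv i :=
  le_ciSup (Set.finite_range P.Rinv).bddAbove i

theorem R_pos (hn : 0 < n) : 0 < P.R :=
  inv_pos.mpr ((P.Rinv_pos ⟨0, hn⟩).trans_le (P.Rinv_le_iSup _))

theorem R_mul_Rinv_le_one (i : Fin n) : P.R * P.Rinv i ≤ 1 := by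
  have h := P.Rinv_le_iSup i
  rw [R, inv_mul_eq_div, div_le_one ((P.Rinv_pos i).trans_le h)]
  exact h

theorem lam0_pos : 0 < P.lam0 := lt_max_of_lt_left one_pos

theorem Lambda1_symm (i j : Fin n) : P.Lambda1 i j = P.Lambda1 j i := by
  rcases eq_or_ne i j with rfl | h
  · rfl
  · simp [Lambda1, h, h.symm, alphaC, betaFull, P.beta_symm i j, mul_comm (P.alpha i)]

theorem Lambda12_symm (i j : Fin n) :
    (P.Lambda1 + P.Lambda2) i j = (P.Lambda1 + P.Lambda2) j i := by
  rw [Matrix.add_apply, Matrix.add_apply, P.Lambda1_symm, Lambda2]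
  rcases eq_or_ne i j with rfl | h
  · rfl
  · simp [h, h.symm]

/-- `Λ_1` is a weighted graph Laplacian in the variables `x_i / α_i`, hence positive
semidefinite. -/
theorem matForm_Lambda1_nonneg (x : Fin n → E) : 0 ≤ matForm P.Lambda1 x x := by
  let b : Fin n → Fin n → ℝ := fun i j => if i = j then 0 else P.beta i j
  have hb : ∀ i j, 0 ≤ b i j := fun i j => by
    by_cases h : i = j
    · simp [b, h]
    · simpa [b, h] using P.beta_nonneg i j h
  have hbs : ∀ i j, b i j = b j i := fun i j => by simp [b, eq_comm, P.beta_symm i j]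
  let y : Fin n → E := fun i => (P.alpha i)⁻¹ • x i
  have hL : ∀ i j, P.Lambda1 i j * inner ℝ (x j) (x i)
      = P.tau * ((if i = j then ∑ k, b i k else 0) - b i j) * inner ℝ (y j) (y i) := by
    intro i j
    have hi := (P.alpha_pos i).ne'
    have hj := (P.alpha_pos j).ne'
    simp only [y, inner_smul_left, inner_smul_right, conj_trivial]
    rcases eq_or_ne i j with rfl | h
    · have : ∑ k ∈ Finset.univ.erase i, P.beta i k = ∑ k, b i k := by
        rw [← Finset.add_sum_erase _ _ (Finset.mem_univ i)]
        simp only [b, if_true, zero_add]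
        exact Finset.sum_congr rfl fun k hk => by rw [if_neg (Finset.ne_of_mem_erase hk).symm]
      simp only [Lambda1, Matrix.of_apply, if_true, alphaC, betaFull, this]
      simp only [b, if_true]
      field_simp
      ring
    · simp only [Lambda1, Matrix.of_apply, alphaC, betaFull, b, if_neg h]
      field_simp
      ring
  have h1 : matForm P.Lambda1 x x
      = P.tau * ∑ i, ∑ j, b i j * (‖y i‖ ^ 2 - inner ℝ (y j) (y i)) := by
    rw [matForm, Finset.mul_sum]
    refine Finset.sum_congr rfl fun i _ => ?_
    rw [Finset.sum_congr rfl fun j _ => hL i j]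
    simp only [mul_sub, sub_mul, Finset.sum_sub_distrib, mul_ite, ite_mul, mul_zero, zero_mul,
      Finset.sum_ite_eq, Finset.mem_univ, if_true, real_inner_self_eq_norm_sq, mul_assoc,
      Finset.sum_mul, Finset.mul_sum]
  have h2 : ∑ i, ∑ j, b i j * (‖y i‖ ^ 2 - inner ℝ (y j) (y i))
      = ∑ i, ∑ j, b i j * (‖y j‖ ^ 2 - inner ℝ (y j) (y i)) := by
    rw [Finset.sum_comm]
    refine Finset.sum_congr rfl fun i _ => Finset.sum_congr rfl fun j _ => ?_
    rw [hbs, real_inner_comm]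
  have h3 : 0 ≤ ∑ i, ∑ j, b i j * ‖y i - y j‖ ^ 2 :=
    Finset.sum_nonneg fun i _ => Finset.sum_nonneg fun j _ => mul_nonneg (hb i j) (sq_nonneg _)
  have h4 : ∑ i, ∑ j, b i j * ‖y i - y j‖ ^ 2
      = ∑ i, ∑ j, b i j * (‖y i‖ ^ 2 - inner ℝ (y j) (y i))
        + ∑ i, ∑ j, b i j * (‖y j‖ ^ 2 - inner ℝ (y j) (y i)) := by
    simp only [← Finset.sum_add_distrib]
    refine Finset.sum_congr rfl fun i _ => Finset.sum_congr rfl fun j _ => ?_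
    rw [norm_sub_sq_real, real_inner_comm]
    ring
  rw [h1]
  refine mul_nonneg P.tau_pos.le ?_
  linarith

theorem matForm_Lambda12_nonneg (x : Fin n → E) : 0 ≤ matForm (P.Lambda1 + P.Lambda2) x x := by
  rw [matForm_add, Lambda2, matForm_diagonal]
  refine add_nonneg (P.matForm_Lambda1_nonneg x) (Finset.sum_nonneg fun i _ => ?_)
  exact mul_nonneg (div_nonneg (P.cp_nonneg i) (sq_nonneg _)) real_inner_self_nonneg

theorem matForm_LambdaE (L : ℝ) (x : Fin n → E) :
    matForm (P.LambdaE L) x x = matForm (P.Lambda1 + P.Lambda2) x x + P.R * ∑ i, ‖x i‖ ^ 2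
      + (1 / P.lam0 + L) * ‖∑ i, x i‖ ^ 2 := by
  rw [LambdaE, Lambda, matForm_add, matForm_add, matForm_add, Lambda3, Lambda4, matForm_diagonal,
    matForm_const, matForm_const]
  simp only [real_inner_self_eq_norm_sq, Finset.mul_sum]
  ring

theorem isUnit_det_LambdaE (hn : 0 < n) {L : ℝ} (hL : 0 ≤ L) : IsUnit (P.LambdaE L).det := by
  rw [isUnit_iff_ne_zero]
  intro h0
  obtain ⟨x, hx0, hx⟩ := Matrix.exists_mulVec_eq_zero_iff.mpr h0
  have h1 : matForm (P.LambdaE L) x x = 0 := by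
    refine Finset.sum_eq_zero fun i _ => ?_
    have h2 : ∑ j, P.LambdaE L i j * x j = 0 := congrFun hx i
    calc ∑ j, P.LambdaE L i j * inner ℝ (x j) (x i) = (∑ j, P.LambdaE L i j * x j) * x i := by
          rw [Finset.sum_mul]
          refine Finset.sum_congr rfl fun j _ => ?_
          simp only [RCLike.inner_apply, conj_trivial]
          ring
      _ = 0 := by rw [h2, zero_mul]
  rw [P.matForm_LambdaE] at h1
  have hl := P.lam0_pos
  have h2 : 0 ≤ (1 / P.lam0 + L) * ‖∑ i, x i‖ ^ 2 := by positivity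
  have h3 := P.matForm_Lambda12_nonneg x
  have h4 : ∑ i, ‖x i‖ ^ 2 ≤ 0 := by
    by_contra! h5
    have := mul_pos (P.R_pos hn) h5
    linarith
  refine hx0 (funext fun i => ?_)
  have h5 := Finset.single_le_sum (f := fun i => ‖x i‖ ^ 2) (fun i _ => sq_nonneg _)
    (Finset.mem_univ i)
  have h6 : ‖x i‖ ^ 2 ≤ 0 := h5.trans h4
  simpa using h6

end Params

/-- Solving `Λ x = y` turns the form `(Λ⁻¹ y, y)` into `(Λ x, x)`. -/
theorem exists_matForm_inv_eq {A : Matrix (Fin n) (Fin n) ℝ} (hA : IsUnit A.det) (F : Submodule ℝ E)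
    {y : Fin n → E} (hy : ∀ i, y i ∈ F) :
    ∃ x : Fin n → E, (∀ i, x i ∈ F) ∧ matForm A⁻¹ y y = matForm A x x ∧
      matForm A x x = ∑ i, inner ℝ (y i) (x i) := by
  have hyx : ∀ i, ∑ j, A i j • ∑ k, A⁻¹ j k • y k = y i := fun i => by
    calc ∑ j, A i j • ∑ k, A⁻¹ j k • y k = ∑ k, (A * A⁻¹) i k • y k := by
          simp only [Finset.smul_sum, smul_smul, Matrix.mul_apply, Finset.sum_smul]
          exact Finset.sum_comm
      _ = y i := by simp [Matrix.mul_nonsing_inv A hA, Matrix.one_apply, ite_smul]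
  have h1 : matForm A (fun j => ∑ k, A⁻¹ j k • y k) (fun j => ∑ k, A⁻¹ j k • y k)
      = ∑ i, inner ℝ (y i) (∑ k, A⁻¹ i k • y k) := by
    refine Finset.sum_congr rfl fun i _ => ?_
    conv_rhs => rw [← hyx i, sum_inner]
    exact Finset.sum_congr rfl fun j _ => by rw [inner_smul_left]; rfl
  refine ⟨_, fun i => F.sum_mem fun k _ => F.smul_mem _ (hy k), ?_, h1⟩
  rw [h1]
  refine Finset.sum_congr rfl fun i _ => ?_
  rw [inner_sum]
  exact Finset.sum_congr rfl fun j _ => by rw [inner_smul_right, real_inner_comm]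

end Forms

/-! ### The flow equations -/

section Flow

variable {n d : ℕ} {Ω ΓuD : Set (Pt d)} {ΓpN : Fin n → Set (Pt d)} {P : Params n} {L : ℝ}

/-- The flow equations with homogeneous data and residual `r`, in the form satisfied by the errors:
`Div v + (Λ_1 + Λ_2) p + L (∑ p) = r` in every component, tested with the pressure space. -/
def ErrorFlow (P : Params n) (L : ℝ) (ΓuD : Set (Pt d)) (v : Fin n → Flux Ω) (p : Fin n → L2 Ω)
    (r : L2 Ω) : Prop :=
  ∀ q : Fin n → L2 Ω, (∀ i, q i ∈ pressureSpace Ω ΓuD) →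
    ∑ i, inner ℝ (fluxDiv (v i)) (q i) + matForm (P.Lambda1 + P.Lambda2) p q
      + L * inner ℝ (∑ i, p i) (∑ i, q i) = inner ℝ r (∑ i, q i)

theorem matForm_Lambda12 (P : Params n) (p q : Fin n → L2 Ω) :
    matForm (P.Lambda1 + P.Lambda2) p q
      = ∑ i, ((P.alphaP i + P.alphaC i i) * inner ℝ (p i) (q i)
        - ∑ j ∈ Finset.univ.erase i, P.alphaC i j * inner ℝ (p j) (q i)) := by
  refine Finset.sum_congr rfl fun i _ => ?_
  rw [← Finset.add_sum_erase _ _ (Finset.mem_univ i), sub_eq_add_neg, ← Finset.sum_neg_distrib]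
  congr 1
  · simp [Params.Lambda1, Params.Lambda2, add_comm]
  · refine Finset.sum_congr rfl fun j hj => ?_
    have h := (Finset.ne_of_mem_erase hj).symm
    simp [Params.Lambda1, Params.Lambda2, h]

theorem FlowStep.errorFlow {f : Fin d → L2 Ω} {g : Fin n → L2 Ω} {s x y : State n Ω}
    (hs : IsWeakSolution P ΓuD ΓpN f g s) (h : FlowStep P L ΓuD ΓpN g x y) :
    ErrorFlow P L ΓuD (s.error y).v (s.error y).p
      (L • ∑ i, (s.error x).p i - dispDiv (s.error x).u) := by
  intro q hq
  rw [matForm_Lambda12, inner_sum, inner_sum, Finset.mul_sum, ← Finset.sum_add_distrib,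
    ← Finset.sum_add_distrib]
  refine Finset.sum_congr rfl fun i _ => ?_
  have h1 := h.1 i (q i) (hq i)
  have h2 := hs.2.2.2 i (q i) (hq i)
  have hdiv : dispDiv (x.u - s.u) = dispDiv x.u - dispDiv s.u := by
    simp [dispDiv, Finset.sum_sub_distrib]
  simp only [State.error, hdiv, fluxDiv, Pi.sub_apply, Prod.snd_sub, inner_sub_left,
    inner_smul_left, Finset.sum_sub_distrib, conj_trivial, mul_sub] at h1 h2 ⊢
  linarith

theorem DarcyEq.sub {v v' : Fin n → Flux Ω} {p p' : Fin n → L2 Ω} (h : DarcyEq P ΓpN v p)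
    (h' : DarcyEq P ΓpN v' p') : DarcyEq P ΓpN (v - v') (p - p') := fun i z hz => by
  have h1 := h i z hz
  have h2 := h' i z hz
  simp only [fluxInner, Pi.sub_apply, Prod.fst_sub, inner_sub_left, Finset.sum_sub_distrib] at *
  linarith

/-- The inf-sup condition for the fluxes bounds the pressures by the fluxes in the Darcy equation. -/
theorem DarcyEq.R_mul_norm_sq_le {βd : ℝ} (hβd : 0 < βd) {v : Fin n → Flux Ω} {p : Fin n → L2 Ω}
    (h : DarcyEq P ΓpN v p) (i : Fin n) (hInfSup : FluxInfSup Ω ΓuD (ΓpN i) βd)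
    (hp : p i ∈ pressureSpace Ω ΓuD) :
    P.R * ‖p i‖ ^ 2 ≤ (βd ^ 2)⁻¹ * (P.Rinv i * fluxInner (v i) (v i)) := by
  have hR := P.R_pos i.pos
  have hRi := P.Rinv_pos i
  have h1 : βd * ‖p i‖ ≤ P.Rinv i * ‖fluxVec (v i)‖ := by
    refine hInfSup.mul_norm_le hp (by positivity) fun z hz => ?_
    have h2 := h i z hz
    have h3 : fluxInner (v i) z ≤ ‖fluxVec (v i)‖ * divNorm z := by
      rw [← inner_fluxVec]
      exact (real_inner_le_norm _ _).trans
        (mul_le_mul_of_nonneg_left (norm_fluxVec_le_divNorm z) (norm_nonneg _))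
    rw [real_inner_comm]
    nlinarith [mul_le_mul_of_nonneg_left h3 hRi.le]
  rw [inv_mul_eq_div, le_div_iff₀' (by positivity), ← norm_fluxVec_sq]
  calc βd ^ 2 * (P.R * ‖p i‖ ^ 2) = P.R * (βd * ‖p i‖) ^ 2 := by ring
    _ ≤ P.R * (P.Rinv i * ‖fluxVec (v i)‖) ^ 2 := by gcongr
    _ = (P.R * P.Rinv i) * (P.Rinv i * ‖fluxVec (v i)‖ ^ 2) := by ring
    _ ≤ 1 * (P.Rinv i * ‖fluxVec (v i)‖ ^ 2) := by
        gcongr; exact P.R_mul_Rinv_le_one i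
    _ = _ := one_mul _

/-- The energy identity of the flow equations, from the test functions `z = v`, `q = p`. -/
theorem ErrorFlow.energy {v : Fin n → Flux Ω} {p : Fin n → L2 Ω} {r : L2 Ω}
    (h : ErrorFlow P L ΓuD v p r) (hD : DarcyEq P ΓpN v p) (hv : ∀ i, v i ∈ fluxSpace Ω (ΓpN i))
    (hp : ∀ i, p i ∈ pressureSpace Ω ΓuD) :
    ∑ i, P.Rinv i * fluxInner (v i) (v i) + matForm (P.Lambda1 + P.Lambda2) p p
      + L * ‖∑ i, p i‖ ^ 2 = inner ℝ r (∑ i, p i) := by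
  rw [← h p hp, real_inner_self_eq_norm_sq]
  congr 2
  refine Finset.sum_congr rfl fun i _ => ?_
  rw [real_inner_comm]
  exact sub_eq_zero.mp (hD i (v i) (hv i))

theorem flux_energy_nonneg (P : Params n) (v : Fin n → Flux Ω) :
    0 ≤ ∑ i, P.Rinv i * fluxInner (v i) (v i) :=
  Finset.sum_nonneg fun i _ => mul_nonneg (P.Rinv_pos i).le
    (by rw [← norm_fluxVec_sq]; positivity)

theorem ErrorFlow.mul_norm_sq_le {v : Fin n → Flux Ω} {p : Fin n → L2 Ω} {r : L2 Ω}
    (h : ErrorFlow P L ΓuD v p r) (hD : DarcyEq P ΓpN v p) (hv : ∀ i, v i ∈ fluxSpace Ω (ΓpN i))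
    (hp : ∀ i, p i ∈ pressureSpace Ω ΓuD) :
    L * ‖∑ i, p i‖ ^ 2 ≤ inner ℝ r (∑ i, p i) := by
  have h1 := h.energy hD hv hp
  have h2 := flux_energy_nonneg P v
  have h3 := P.matForm_Lambda12_nonneg p
  linarith

theorem ErrorFlow.mul_norm_le {v : Fin n → Flux Ω} {p : Fin n → L2 Ω} {r : L2 Ω}
    (h : ErrorFlow P L ΓuD v p r) (hD : DarcyEq P ΓpN v p) (hv : ∀ i, v i ∈ fluxSpace Ω (ΓpN i))
    (hp : ∀ i, p i ∈ pressureSpace Ω ΓuD) : L * ‖∑ i, p i‖ ≤ ‖r‖ := by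
  have h1 := (h.mul_norm_sq_le hD hv hp).trans (real_inner_le_norm _ _)
  rcases eq_or_lt_of_le (norm_nonneg (∑ i, p i)) with h0 | h0
  · rw [← h0]; simp
  · refine le_of_mul_le_mul_right ?_ h0
    linarith

/-- The flux and pressure errors are controlled by the residual: with `ρ² = ‖r‖² / L`, all terms of
the energy identity are at most `ρ²`. For the `Λ_e⁻¹` part of the flux norm, the flow equations are
tested with `q = Λ_e⁻¹ Div v`. -/
theorem ErrorFlow.normVe_add_normPe_le {v : Fin n → Flux Ω} {p : Fin n → L2 Ω} {r : L2 Ω}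
    (h : ErrorFlow P L ΓuD v p r) (hD : DarcyEq P ΓpN v p) (hv : ∀ i, v i ∈ fluxSpace Ω (ΓpN i))
    (hp : ∀ i, p i ∈ pressureSpace Ω ΓuD) (hn : 0 < n) (hΩm : MeasurableSet Ω)
    (hΩ : Bornology.IsBounded Ω) (hΓ : ΓuD = frontier Ω → ∀ i, ΓpN i = frontier Ω)
    {βd cK : ℝ} (hβd : 0 < βd) (hInfSup : ∀ i, FluxInfSup Ω ΓuD (ΓpN i) βd)
    (hcK : 0 < cK) (hL : 1 / (P.lam + cK ^ 2) ≤ L) :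
    normVe P L v + normPe P L p ≤ (2 + √(2 + (βd ^ 2)⁻¹ + cK ^ 2)) * (‖r‖ / √L) := by
  have hlam := P.lam_pos
  have hL0 : 0 < L := lt_of_lt_of_le (by positivity) hL
  have hE := h.energy hD hv hp
  have hW := flux_energy_nonneg P v
  have hQ := P.matForm_Lambda12_nonneg p
  have hσ : (0 : ℝ) ≤ L * ‖∑ i, p i‖ ^ 2 := by positivity
  set W := ∑ i, P.Rinv i * fluxInner (v i) (v i) with hWd
  set σ := ∑ i, p i with hσd
  set e := inner ℝ r σ with he
  have hρ : (‖r‖ / √L) ^ 2 = ‖r‖ ^ 2 / L := by rw [div_pow, Real.sq_sqrt hL0.le]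
  have heρ : e ≤ (‖r‖ / √L) ^ 2 := by
    rw [hρ, le_div_iff₀ hL0]
    have h1 : L * ‖σ‖ ≤ ‖r‖ := h.mul_norm_le hD hv hp
    have h2 : e ≤ ‖r‖ * ‖σ‖ := real_inner_le_norm _ _
    calc e * L ≤ ‖r‖ * ‖σ‖ * L := by gcongr
      _ = ‖r‖ * (L * ‖σ‖) := by ring
      _ ≤ ‖r‖ * ‖r‖ := by gcongr
      _ = _ := (sq _).symm
  have hρ0 : 0 ≤ ‖r‖ / √L := by positivity
  have hlam0 : 1 / P.lam0 ≤ (1 + cK ^ 2) * L := by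
    have h1 : P.lam + cK ^ 2 ≤ (1 + cK ^ 2) * P.lam0 := by
      have h2 : 1 ≤ P.lam0 := le_max_left _ _
      have h3 : P.lam ≤ P.lam0 := le_max_right _ _
      nlinarith [sq_nonneg cK]
    have h2 : 1 / P.lam0 ≤ (1 + cK ^ 2) * (1 / (P.lam + cK ^ 2)) := by
      rw [mul_one_div, div_le_div_iff₀ P.lam0_pos (by positivity)]
      linarith
    exact h2.trans (by gcongr)
  have hPe : normPe P L p ≤ √(2 + (βd ^ 2)⁻¹ + cK ^ 2) * (‖r‖ / √L) := by
    rw [← Real.sqrt_sq hρ0, ← Real.sqrt_mul (by positivity)]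
    refine Real.sqrt_le_sqrt ?_
    change matForm (P.LambdaE L) p p ≤ _
    rw [P.matForm_LambdaE, ← hσd]
    have h1 : P.R * ∑ i, ‖p i‖ ^ 2 ≤ (βd ^ 2)⁻¹ * W := by
      rw [Finset.mul_sum, hWd, Finset.mul_sum]
      exact Finset.sum_le_sum fun i _ => hD.R_mul_norm_sq_le hβd i (hInfSup i) (hp i)
    have h2 : 1 / P.lam0 * ‖σ‖ ^ 2 ≤ (1 + cK ^ 2) * e := by
      calc 1 / P.lam0 * ‖σ‖ ^ 2 ≤ (1 + cK ^ 2) * L * ‖σ‖ ^ 2 := by gcongr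
        _ = (1 + cK ^ 2) * (L * ‖σ‖ ^ 2) := by ring
        _ ≤ (1 + cK ^ 2) * e := by gcongr; linarith
    have h3 : (βd ^ 2)⁻¹ * W ≤ (βd ^ 2)⁻¹ * e := by gcongr; linarith
    calc _ ≤ (2 + (βd ^ 2)⁻¹ + cK ^ 2) * e := by linarith
      _ ≤ _ := by gcongr
  have hVe : normVe P L v ≤ 2 * (‖r‖ / √L) := by
    refine Real.sqrt_le_iff.mpr ⟨by positivity, ?_⟩
    rw [mul_pow]
    change W + matForm (P.LambdaE L)⁻¹ (fun i => fluxDiv (v i)) (fun i => fluxDiv (v i)) ≤ _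
    obtain ⟨F, hF, -⟩ := pressureSpace_eq_submodule hΩm hΩ ΓuD
    have hFmem : ∀ q, q ∈ F ↔ q ∈ pressureSpace Ω ΓuD := fun u => by rw [← hF]; rfl
    obtain ⟨x, hxF, hx1, hx2⟩ := exists_matForm_inv_eq (P.isUnit_det_LambdaE hn hL0.le) F
      (y := fun i => fluxDiv (v i)) fun i => (hFmem _).mpr
        (fluxDiv_mem_pressureSpace hΩm hΩ (fun hu => hΓ hu i) (hv i))
    rw [hx1]
    have hxeq := h x fun i => (hFmem _).mp (hxF i)
    rw [← hx2] at hxeq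
    have hXe := P.matForm_LambdaE L x
    set X := matForm (P.LambdaE L) x x with hX
    set ξ := ∑ i, x i with hξ
    have hR : 0 ≤ P.R * ∑ i, ‖x i‖ ^ 2 :=
      mul_nonneg (P.R_pos hn).le (Finset.sum_nonneg fun i _ => sq_nonneg _)
    have hl : 0 ≤ 1 / P.lam0 * ‖ξ‖ ^ 2 := by have := P.lam0_pos; positivity
    have a1 := P.matForm_Lambda12_nonneg (x + (2 : ℝ) • p)
    rw [matForm_add_smul_self P.Lambda12_symm, matForm_comm P.Lambda12_symm x p] at a1
    have a2 : 0 ≤ L * ‖ξ + (2 : ℝ) • σ‖ ^ 2 := by positivity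
    rw [norm_add_sq_real, norm_smul, inner_smul_right, real_inner_comm, Real.norm_two] at a2
    have a3 : inner ℝ r ξ ≤ L * ‖ξ‖ ^ 2 / 4 + ‖r‖ ^ 2 / L := by
      have b1 : inner ℝ r ξ ≤ ‖r‖ * ‖ξ‖ := real_inner_le_norm _ _
      have b2 : 0 ≤ (L * ‖ξ‖ / 2 - ‖r‖) ^ 2 / L := by positivity
      have b3 : (L * ‖ξ‖ / 2 - ‖r‖) ^ 2 / L = L * ‖ξ‖ ^ 2 / 4 + ‖r‖ ^ 2 / L - ‖r‖ * ‖ξ‖ := by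
        field_simp
        ring
      linarith
    rw [← hρ] at a3
    change X + matForm (P.Lambda1 + P.Lambda2) p x + L * inner ℝ σ ξ = inner ℝ r ξ at hxeq
    have a4 := P.matForm_Lambda12_nonneg x
    nlinarith
  linarith

end Flow

/-! ### Geometric decay of the errors -/

/-- The rate is bounded below independently of `λ` and `L`. -/
theorem one_le_mul_rate_sq {β cK L lam : ℝ} (hβ : 0 < β) (hcK : 0 < cK) (hlam : 0 < lam)
    (hL : 1 / (lam + cK ^ 2) ≤ L) : 1 ≤ (2 + cK ^ 2 * β ^ 2) * rate β L lam ^ 2 := by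
  have hc : 0 < lam + cK ^ 2 := by positivity
  have hL0 : 0 < L := lt_of_lt_of_le (by positivity) hL
  have hb : 0 < (β ^ 2)⁻¹ + lam := by positivity
  have h1 : 1 / ((β ^ 2)⁻¹ + lam) ≤ (1 + cK ^ 2 * β ^ 2) * (1 / (lam + cK ^ 2)) := by
    rw [mul_one_div, div_le_div_iff₀ hb hc]
    have h2 : cK ^ 2 * β ^ 2 * (β ^ 2)⁻¹ = cK ^ 2 := by field_simp
    have h3 : 0 ≤ cK ^ 2 * β ^ 2 * lam := by positivity
    have h4 : 0 < (β ^ 2)⁻¹ := by positivity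
    nlinarith
  have h2 : 1 / ((β ^ 2)⁻¹ + lam) ≤ (1 + cK ^ 2 * β ^ 2) * L := h1.trans (by gcongr)
  rw [rate_sq hβ hL0 hlam, mul_div_assoc', le_div_iff₀ (by positivity)]
  linarith

theorem le_geometric {a : ℕ → ℝ} {ρ : ℝ} (hρ : 0 ≤ ρ) {k : ℕ}
    (h : ∀ m, k ≤ m → a (m + 1) ≤ ρ * a m) (m : ℕ) : a (k + m) ≤ ρ ^ m * a k := by
  induction m with
  | zero => simp
  | succ m ih =>
    calc a (k + (m + 1)) ≤ ρ * a (k + m) := h _ (Nat.le_add_right _ _)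
      _ ≤ ρ * (ρ ^ m * a k) := by gcongr
      _ = _ := by ring

end MPET

end

open MPET
theorem theorem3p2 {d : ℕ} (hd : d = 2 ∨ d = 3) (Ω : Set (Pt d))
    (hΩ : IsBoundedLipschitzDomain Ω) (ΓuD : Set (Pt d)) (hΓuD : IsBoundaryPart Ω ΓuD)
    (cK βs βd : ℝ) (hcK : 0 < cK) (hβs : 0 < βs) (hβd : 0 < βd)
    (hKorn : ∀ w ∈ dispSpace Ω ΓuD, cK * ‖dispDiv w‖ ≤ strainNorm w)
    (hInfSup : DispInfSup Ω ΓuD βs) :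
    ∃ Cu Cvp : ℝ, 0 < Cu ∧ 0 < Cvp ∧
      ∀ (n : ℕ), 0 < n →
      ∀ (ΓpN : Fin n → Set (Pt d)), (∀ i, IsBoundaryPart Ω (ΓpN i)) →
      (ΓuD = frontier Ω → ∀ i, ΓpN i = frontier Ω) →
      (∀ i, FluxInfSup Ω ΓuD (ΓpN i) βd) →
      ∀ (P : Params n) (L : ℝ), 1 / (P.lam + cK ^ 2) ≤ L →
      ∀ (f : Fin d → L2 Ω) (g : Fin n → L2 Ω) (s : State n Ω),
      IsWeakSolution P ΓuD ΓpN f g s →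
      ∀ (x : ℕ → State n Ω), IsFixedStressIteration P L ΓuD ΓpN f g x →
      ∀ (e : ℕ → State n Ω), (∀ m, e m = s.error (x m)) →
        -- arbitrary initial guess
        ((∀ m, 1 ≤ m → ‖∑ i, (e (m + 1)).p i‖ ≤ rate βs L P.lam * ‖∑ i, (e m).p i‖) ∧
          (∀ m, normU P (e m).u ≤
            Cu * (‖∑ i, (e 0).p i‖ + normU P (e 0).u) * rate βs L P.lam ^ m) ∧
          (∀ m, 1 ≤ m → normVe P L (e m).v + normPe P L (e m).p ≤
            Cvp * (√L * ‖∑ i, (e 0).p i‖ + normU P (e 0).u) * rate βs L P.lam ^ m)) ∧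
        -- initial guess whose displacement is computed from its pressures
        (MechanicsEq P ΓuD f (x 0).u (x 0).p →
          (∀ m, ‖∑ i, (e (m + 1)).p i‖ ≤ rate βs L P.lam * ‖∑ i, (e m).p i‖) ∧
          (∀ m, normU P (e m).u ≤ Cu * ‖∑ i, (e 0).p i‖ * rate βs L P.lam ^ m) ∧
          (∀ m, 1 ≤ m → normVe P L (e m).v + normPe P L (e m).p ≤
            Cvp * (√L * ‖∑ i, (e 0).p i‖) * rate βs L P.lam ^ m)) := by
  set κ : ℝ := 2 + cK ^ 2 * βs ^ 2 with hκ
  set C₀ : ℝ := 2 + √(2 + (βd ^ 2)⁻¹ + cK ^ 2) with hC₀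
  have hκ1 : 1 ≤ κ := by
    have : 0 ≤ cK ^ 2 * βs ^ 2 := by positivity
    linarith
  have hC₀0 : 0 < C₀ := by positivity
  refine ⟨(1 / cK + 1) * κ, 2 * C₀ * κ, by positivity, by positivity, ?_⟩
  intro n hn ΓpN _ hΓ hFlux P L hL f g s hs x hx e he
  have hΩm : MeasurableSet Ω := hΩ.1.measurableSet
  have hΩb : Bornology.IsBounded Ω := hΩ.2.2.1
  have hlam := P.lam_pos
  have hc : 0 < P.lam + cK ^ 2 := by positivity
  have hL0 : 0 < L := lt_of_lt_of_le (by positivity) hL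
  have hLc : 1 ≤ L * (P.lam + cK ^ 2) := (div_le_iff₀ hc).mp hL
  set ρ := rate βs L P.lam with hρ
  have hρ0 : 0 ≤ ρ := Real.sqrt_nonneg _
  have hκρ : 1 ≤ κ * ρ ^ 2 := one_le_mul_rate_sq hβs hcK hlam hL
  have hρ1 : ρ ≤ 1 := by
    rw [hρ, rate, Real.sqrt_le_iff, one_pow]
    have : 0 ≤ L⁻¹ / ((βs ^ 2)⁻¹ + P.lam) := by positivity
    exact ⟨zero_le_one, (div_le_one (by linarith)).mpr (by linarith)⟩
  have hκρ1 : 1 ≤ κ * ρ := hκρ.trans (by gcongr; nlinarith)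
  -- membership of the errors in the spaces, and the error equations
  have hpmem : ∀ m i, (e m).p i ∈ pressureSpace Ω ΓuD := fun m i => by
    obtain ⟨F, hF, -⟩ := pressureSpace_eq_submodule hΩm hΩb ΓuD
    have h1 := (hx m).1.2.2 i
    have h2 := hs.1.2.2 i
    rw [he, ← hF] at *
    exact F.sub_mem h1 h2
  have hσmem : ∀ m, ∑ i, (e m).p i ∈ pressureSpace Ω ΓuD := fun m => by
    obtain ⟨F, hF, -⟩ := pressureSpace_eq_submodule hΩm hΩb ΓuD
    have h1 := hpmem m
    rw [← hF] at *
    exact F.sum_mem fun i _ => h1 i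
  have humem : ∀ m, (e m).u ∈ dispSpace Ω ΓuD := fun m => by
    rw [he]
    exact dispSpace_sub_mem (hx m).1.1 hs.1.1
  have hvmem : ∀ m i, (e m).v i ∈ fluxSpace Ω (ΓpN i) := fun m i => by
    rw [he]
    exact fluxSpace_sub_mem ((hx m).1.2.1 i) (hs.1.2.1 i)
  have hmech : ∀ m, MechanicsEq P ΓuD f (x m).u (x m).p →
      ErrorMechanics P ΓuD (e m).u (∑ i, (e m).p i) := fun m h => by
    rw [he]
    exact h.errorMechanics hs.2.1
  have hmech1 : ∀ m, 1 ≤ m → MechanicsEq P ΓuD f (x m).u (x m).p := fun m hm => by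
    obtain ⟨k, rfl⟩ := Nat.exists_eq_add_of_le' hm
    exact (hx k).2.2
  have hflow : ∀ m, ErrorFlow P L ΓuD (e (m + 1)).v (e (m + 1)).p
      (L • ∑ i, (e m).p i - dispDiv (e m).u) := fun m => by
    rw [he, he]
    exact (hx m).2.1.errorFlow hs
  have hdarcy : ∀ m, DarcyEq P ΓpN (e (m + 1)).v (e (m + 1)).p := fun m => by
    rw [he]
    exact (hx m).2.1.2.sub hs.2.2.1
  set σ : ℕ → ℝ := fun m => ‖∑ i, (e m).p i‖ with hσ
  set r : ℕ → ℝ := fun m => ‖L • ∑ i, (e m).p i - dispDiv (e m).u‖ with hr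
  have hσ0 : ∀ m, 0 ≤ σ m := fun m => norm_nonneg _
  have hU0 : ∀ m, 0 ≤ normU P (e m).u := fun m => Real.sqrt_nonneg _
  -- one step of the iteration
  have hcontr : ∀ m, MechanicsEq P ΓuD f (x m).u (x m).p → σ (m + 1) ≤ ρ * σ m := fun m h =>
    (hmech m h).norm_le_rate_mul hΩm hΩb hβs hInfSup hcK hKorn hL (humem m) (humem (m + 1))
      (hσmem m) (hσmem (m + 1)) (hmech (m + 1) (hx m).2.2)
      ((hflow m).mul_norm_sq_le (hdarcy m) (hvmem (m + 1)) (hpmem (m + 1)))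
  have hstep : ∀ m, normVe P L (e (m + 1)).v + normPe P L (e (m + 1)).p ≤ C₀ * (r m / √L) :=
    fun m => (hflow m).normVe_add_normPe_le (hdarcy m) (hvmem (m + 1)) (hpmem (m + 1)) hn hΩm hΩb
      hΓ hβd hFlux hcK hL
  have hσr : ∀ m, L * σ (m + 1) ≤ r m := fun m =>
    (hflow m).mul_norm_le (hdarcy m) (hvmem (m + 1)) (hpmem (m + 1))
  have hUσ : ∀ m, MechanicsEq P ΓuD f (x m).u (x m).p →
      √(P.lam + cK ^ 2) * normU P (e m).u ≤ σ m := fun m h => by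
    have h1 := (hmech m h).mul_norm_energyMap_sq_le hcK hKorn (humem m)
    rw [← normU_eq] at h1
    refine le_of_sq_le_sq ?_ (hσ0 m)
    rwa [mul_pow, Real.sq_sqrt hc.le]
  have hdiv : ∀ m, √(P.lam + cK ^ 2) * ‖dispDiv (e m).u‖ ≤ normU P (e m).u := fun m => by
    have h1 := mul_norm_dispDiv_sq_le (P := P) hcK hKorn (humem m)
    rw [← normU_eq] at h1
    refine le_of_sq_le_sq ?_ (hU0 m)
    rwa [mul_pow, Real.sq_sqrt hc.le]
  have hsc : cK ≤ √(P.lam + cK ^ 2) := Real.le_sqrt_of_sq_le (by linarith)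
  set c := √(P.lam + cK ^ 2) with hcd
  have hc0 : 0 < c := Real.sqrt_pos.mpr hc
  have hsL : 0 < √L := Real.sqrt_pos.mpr hL0
  have hLs : √L * √L = L := Real.mul_self_sqrt hL0.le
  have hsLc : 1 ≤ √L * c := by
    rw [hcd, ← Real.sqrt_mul hL0.le]
    exact Real.one_le_sqrt.mpr hLc
  have hdivL : ∀ m, ‖dispDiv (e m).u‖ ≤ √L * normU P (e m).u := fun m => by
    calc ‖dispDiv (e m).u‖ ≤ √L * c * ‖dispDiv (e m).u‖ :=
          le_mul_of_one_le_left (norm_nonneg _) hsLc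
      _ = √L * (c * ‖dispDiv (e m).u‖) := by ring
      _ ≤ _ := by gcongr; exact hdiv m
  have hrle : ∀ m, r m / √L ≤ √L * σ m + normU P (e m).u := fun m => by
    rw [div_le_iff₀ hsL]
    calc r m ≤ ‖L • ∑ i, (e m).p i‖ + ‖dispDiv (e m).u‖ := norm_sub_le _ _
      _ ≤ L * σ m + √L * normU P (e m).u := by
          rw [norm_smul, Real.norm_of_nonneg hL0.le]
          exact add_le_add_right (hdivL m) _
      _ = (√L * √L) * σ m + √L * normU P (e m).u := by rw [hLs]
      _ = _ := by ring
  have hUσL : ∀ m, MechanicsEq P ΓuD f (x m).u (x m).p → normU P (e m).u ≤ √L * σ m :=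
    fun m h => by
    calc normU P (e m).u ≤ √L * c * normU P (e m).u := le_mul_of_one_le_left (hU0 m) hsLc
      _ = √L * (c * normU P (e m).u) := by ring
      _ ≤ _ := by gcongr; exact hUσ m h
  have hrle' : ∀ m, MechanicsEq P ΓuD f (x m).u (x m).p → r m / √L ≤ 2 * (√L * σ m) :=
    fun m h => by linarith [hrle m, hUσL m h]
  have hσ1r : √L * σ 1 ≤ r 0 / √L := by
    rw [le_div_iff₀ hsL]
    calc √L * σ 1 * √L = √L * √L * σ 1 := by ring
      _ ≤ r 0 := by rw [hLs]; exact hσr 0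
  refine ⟨⟨fun m hm => hcontr m (hmech1 m hm), fun m => ?_, fun m hm => ?_⟩, fun h0 => ?_⟩
  · have hA : 0 ≤ σ 0 + normU P (e 0).u := add_nonneg (hσ0 0) (hU0 0)
    rcases m with _ | k
    · rw [pow_zero, mul_one]
      have h1 : 1 ≤ (1 / cK + 1) * κ := one_le_mul_of_one_le_of_one_le
        (by linarith [one_div_pos.mpr hcK]) hκ1
      calc normU P (e 0).u ≤ 1 * (σ 0 + normU P (e 0).u) := by linarith [hσ0 0]
        _ ≤ _ := by gcongr
    · have h1 := le_geometric hρ0 (fun m hm => hcontr m (hmech1 m hm)) k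
      have h2 := hUσ (k + 1) (hx k).2.2
      rw [add_comm 1 k] at h1
      -- `‖∑ e_p^1‖ / c` is bounded uniformly in `λ`, although `‖∑ e_p^1‖` is not
      have h3 : σ 1 ≤ c * ((1 / cK + 1) * (σ 0 + normU P (e 0).u)) := by
        have h4 : √L * σ 1 ≤ √L * σ 0 + normU P (e 0).u := hσ1r.trans (hrle 0)
        have h5 : √L * σ 1 ≤ √L * (σ 0 + c * normU P (e 0).u) := by
          have := mul_le_mul_of_nonneg_right hsLc (hU0 0)
          linarith
        have h6 : σ 1 ≤ σ 0 + c * normU P (e 0).u := le_of_mul_le_mul_left h5 hsL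
        have h7 : σ 0 ≤ c * (1 / cK * σ 0) := by
          rw [← mul_assoc, mul_one_div]
          exact le_mul_of_one_le_left (hσ0 0) ((one_le_div hcK).mpr hsc)
        have h8 : 0 ≤ c * (1 / cK * normU P (e 0).u) :=
          mul_nonneg hc0.le (mul_nonneg (by positivity) (hU0 0))
        have h9 : 0 ≤ c * σ 0 := mul_nonneg hc0.le (hσ0 0)
        linarith
      refine le_of_mul_le_mul_left ?_ hc0
      calc c * normU P (e (k + 1)).u ≤ ρ ^ k * σ 1 := h2.trans h1
        _ ≤ ρ ^ k * (c * ((1 / cK + 1) * (σ 0 + normU P (e 0).u))) := by gcongr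
        _ = 1 * (c * ((1 / cK + 1) * (σ 0 + normU P (e 0).u)) * ρ ^ k) := by ring
        _ ≤ κ * ρ * (c * ((1 / cK + 1) * (σ 0 + normU P (e 0).u)) * ρ ^ k) := by gcongr
        _ = c * ((1 / cK + 1) * κ * (σ 0 + normU P (e 0).u) * ρ ^ (k + 1)) := by ring
  · have hA : 0 ≤ √L * σ 0 + normU P (e 0).u := add_nonneg (mul_nonneg hsL.le (hσ0 0)) (hU0 0)
    obtain ⟨k, rfl⟩ := Nat.exists_eq_add_of_le' hm
    rcases k with _ | k
    · calc _ ≤ C₀ * (r 0 / √L) := hstep 0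
        _ ≤ C₀ * (√L * σ 0 + normU P (e 0).u) := by gcongr; exact hrle 0
        _ = 1 * 1 * (C₀ * (√L * σ 0 + normU P (e 0).u)) := by ring
        _ ≤ 2 * (κ * ρ) * (C₀ * (√L * σ 0 + normU P (e 0).u)) := by gcongr; norm_num
        _ = _ := by ring
    · have h1 := le_geometric hρ0 (fun m hm => hcontr m (hmech1 m hm)) k
      rw [add_comm 1 k] at h1
      calc _ ≤ C₀ * (r (k + 1) / √L) := hstep (k + 1)
        _ ≤ C₀ * (2 * (√L * σ (k + 1))) := by gcongr; exact hrle' _ (hx k).2.2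
        _ ≤ C₀ * (2 * (√L * (ρ ^ k * σ 1))) := by gcongr
        _ = C₀ * (2 * ρ ^ k * (√L * σ 1)) := by ring
        _ ≤ C₀ * (2 * ρ ^ k * (√L * σ 0 + normU P (e 0).u)) := by
            gcongr; exact hσ1r.trans (hrle 0)
        _ = 1 * (C₀ * (2 * ρ ^ k * (√L * σ 0 + normU P (e 0).u))) := by ring
        _ ≤ κ * ρ ^ 2 * (C₀ * (2 * ρ ^ k * (√L * σ 0 + normU P (e 0).u))) := by gcongr
        _ = _ := by ring
  · have hall : ∀ m, MechanicsEq P ΓuD f (x m).u (x m).p := fun m => by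
      rcases m with _ | k
      · exact h0
      · exact (hx k).2.2
    have hgeo : ∀ m, σ m ≤ ρ ^ m * σ 0 := fun m => by
      simpa using le_geometric hρ0 (k := 0) (fun m _ => hcontr m (hall m)) m
    refine ⟨fun m => hcontr m (hall m), fun m => ?_, fun m hm => ?_⟩
    · refine le_of_mul_le_mul_left ?_ hcK
      calc cK * normU P (e m).u ≤ c * normU P (e m).u := by gcongr; exact hU0 m
        _ ≤ ρ ^ m * σ 0 := (hUσ m (hall m)).trans (hgeo m)
        _ = 1 * (1 * (σ 0 * ρ ^ m)) := by ring
        _ ≤ (1 + cK) * (κ * (σ 0 * ρ ^ m)) := by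
            have := hσ0 0
            gcongr
            linarith
        _ = cK * ((1 / cK + 1) * κ * σ 0 * ρ ^ m) := by field_simp
    · obtain ⟨k, rfl⟩ := Nat.exists_eq_add_of_le' hm
      have hs0 := hσ0 0
      calc _ ≤ C₀ * (r k / √L) := hstep k
        _ ≤ C₀ * (2 * (√L * σ k)) := by gcongr; exact hrle' _ (hall k)
        _ ≤ C₀ * (2 * (√L * (ρ ^ k * σ 0))) := by gcongr; exact hgeo k
        _ = 1 * (C₀ * (2 * (√L * (ρ ^ k * σ 0)))) := by ring
        _ ≤ κ * ρ * (C₀ * (2 * (√L * (ρ ^ k * σ 0)))) := by gcongr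
        _ = _ := by ring
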